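/- Let $n\ge 2$, $p\in(1,\infty)$, $Q\ge1$, $C_o\ge1$, $\mathbb{R}^n_+=\{x=(x',x_n)\in\mathbb{R}^{n-1}\times\mathbb{R}:x_n>0\}$, $B_R^+(x)=B_R(x)\cap\mathbb{R}^n_+$, and let $F,G$ be non-negative Borel functions with $$\max\{F(\tau),G(\tau)\}\le C_o(1-\tau^2)^p\quad\text{and}\quad F(\tau)\ge\tfrac1{C_o}(1-\tau^2)^p\qquad\text{for }\tau\in[-1,1].$$ For a bounded open set $\Omega\subset\mathbb{R}^n$ and a locally Lipschitz $u:\mathbb{R}^n\to[-1,1]$ put $$\mathcal{E}_\Omega(u)=\int_{\Omega\cap\mathbb{R}^n_+}\big(|\nabla u|^p+F(u)\big)\,dx+\int_{\Omega\cap\{x_n=0\}}G(u(x',0))\,dx',\qquad \mathcal{E}_{R,x_o}(u)=\mathcal{E}_{B_R(x_o)}(u).$$ A Lipschitz function $u:\mathbb{R}^n\to[-1,1]$ is called a $Q$-minimizer if, for every bounded open $\Omega\subset\mathbb{R}^n$, $\mathcal{E}_\Omega(u)<+\infty$ and $\mathcal{E}_\Omega(u)\le Q\,\mathcal{E}_\Omega(u+\varphi)$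 for every Lipschitz function $\varphi$ supported in $\Omega$ such that $u+\varphi$ takes values in $[-1,1]$. **Theorem 1.** Let $u$ be a Lipschitz $Q$-minimizer with Lipschitz constant $L$. (i) There is $C_*>0$, depending only on $n,Q,p,C_o,L$, such that $\mathcal{E}_{R,x_o}(u)\le C_*R^{n-1}$ for every $x_o\in\overline{\mathbb{R}^n_+}$ and every $R\ge1$. (ii) Let $\theta\in(-1,1)$ and $\mu_1,\mu_2>0$. There are $r_0,c>0$, depending only on $n,Q,p,C_o,L,\theta,\mu_1,\mu_2$, such that for every $x_o\in\overline{\mathbb{R}^n_+}$: if $\mathcal{L}^n(B^+_{\mu_1}(x_o)\cap\{u>\theta\})\ge\mu_2$, then $\mathcal{L}^n(B^+_r(x_o)\cap\{u>\theta\})\ge c\,r^n$ for all $r\ge r_0$; and if $\mathcal{L}^n(B^+_{\mu_1}(x_o)\cap\{u<\theta\})\ge\mu_2$, then $\mathcal{L}^n(B^+_r(x_o)\cap\{u<\theta\})\ge c\,r^n$ for all $r\ge r_0$. -/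

import Mathlib

open MeasureTheory Set
open scoped ENNReal NNReal

namespace TracePhase

/-- The Euclidean space `ℝ^d`. -/
abbrev Space (d : ℕ) : Type := EuclideanSpace ℝ (Fin d)

/-- The open half-space `ℝ^n_+ = {x_n > 0}` of `ℝ^n`, where `n = m + 1`. -/
def halfSpace (m : ℕ) : Set (Space (m + 1)) := {x | 0 < x (Fin.last m)}

/-- The embedding `x' ↦ (x', 0)` of `ℝ^(n-1)` onto the hyperplane `{x_n = 0}`, `n = m + 1`. -/
def toHyperplane {m : ℕ} (x' : Space m) : Space (m + 1) :=
  WithLp.toLp 2 (Fin.snoc (α := fun _ => ℝ) (fun i => x' i) 0)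

/-- The half ball `B_R^+(x₀) = B_R(x₀) ∩ ℝ^n_+`. -/
def halfBall {m : ℕ} (x₀ : Space (m + 1)) (R : ℝ) : Set (Space (m + 1)) :=
  Metric.ball x₀ R ∩ halfSpace m

/-- The energy
`E_Ω(u) = ∫_{Ω ∩ ℝ^n_+} (|∇u|^p + F(u)) dx + ∫_{Ω ∩ {x_n = 0}} G(u(x', 0)) dx'`,
with values in `[0, ∞]`. It is used for Lipschitz functions `u` with values in `[-1, 1]` and for
`F`, `G` non-negative on `[-1, 1]`. A Lipschitz function is differentiable almost everywhere, its
classical gradient is its weak gradient, and the operator norm of `fderiv ℝ u x` is the Euclidean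
norm of the gradient. -/
noncomputable def energy {m : ℕ} (p : ℝ) (F G : ℝ → ℝ) (Ω : Set (Space (m + 1)))
    (u : Space (m + 1) → ℝ) : ℝ≥0∞ :=
  (∫⁻ x in Ω ∩ halfSpace m, ENNReal.ofReal (‖fderiv ℝ u x‖ ^ p + F (u x))) +
    ∫⁻ x' in {x' : Space m | toHyperplane x' ∈ Ω}, ENNReal.ofReal (G (u (toHyperplane x')))

/-- The assumptions on the potentials: they are Borel and non-negative, and
`max {F, G} ≤ C₀ (1 - τ²)^p` and `F ≥ (1 / C₀) (1 - τ²)^p`. Only the values on `[-1, 1]`, where the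
power makes sense for every real `p` and where the energy is evaluated, are restricted. -/
structure IsDoubleWell (p C₀ : ℝ) (F G : ℝ → ℝ) : Prop where
  measurable_F : Measurable F
  measurable_G : Measurable G
  nonneg : ∀ τ ∈ Icc (-1 : ℝ) 1, 0 ≤ F τ ∧ 0 ≤ G τ
  upper : ∀ τ ∈ Icc (-1 : ℝ) 1, max (F τ) (G τ) ≤ C₀ * (1 - τ ^ 2) ^ p
  lower : ∀ τ ∈ Icc (-1 : ℝ) 1, (1 / C₀) * (1 - τ ^ 2) ^ p ≤ F τ

/-- `Q`-minimizers, among functions with values in `[-1, 1]`. The finiteness and the minimality are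
required on every bounded open set `Ω`, the latter for all Lipschitz perturbations supported in `Ω`
for which the energy of the perturbed function is defined. -/
structure IsQMinimizer {m : ℕ} (p Q : ℝ) (F G : ℝ → ℝ) (u : Space (m + 1) → ℝ) : Prop where
  mem_Icc : ∀ x, u x ∈ Icc (-1 : ℝ) 1
  energy_lt_top : ∀ Ω : Set (Space (m + 1)), IsOpen Ω → Bornology.IsBounded Ω →
    energy p F G Ω u < ∞
  energy_le : ∀ Ω : Set (Space (m + 1)), IsOpen Ω → Bornology.IsBounded Ω →
    ∀ φ : Space (m + 1) → ℝ, (∃ K : ℝ≥0, LipschitzWith K φ) → tsupport φ ⊆ Ω →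
      (∀ x, u x + φ x ∈ Icc (-1 : ℝ) 1) →
      energy p F G Ω u ≤ ENNReal.ofReal Q * energy p F G Ω (fun x => u x + φ x)

end TracePhase

/-! Both parts rest on one comparison. Inside a ball `u` is replaced by `-1` through a cutoff of
unit width. Both potentials vanish at `-1` and are at most a multiple of `(1 + u)^p`, so the
competitor has energy only in an annulus of bounded width. Its surface energy is moved into the bulk
by a trace inequality along vertical unit segments. Minimality then gives the Caccioppoli inequality
`energy_ball_le_lintegral_annulus`, whose right side is the integral of `(1 + u + |∇u|)^p` over an
annulus. The integrand is at most `(2 + L)^p` and the annulus has volume `O(R^(n-1))`, which is (i).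

For (ii), let `V(r)` be the volume of `{u > θ}` in the half ball, `E(r)` the bulk energy there, and
`X = V + E`. The Sobolev inequality `lintegral_halfSpace_rpow_le` is applied to a truncation of `u`
times a cutoff. The gradient of the truncation lives where `u` is away from both wells; there `F` is
bounded below, so `|∇u|` is at most a multiple of `|∇u|^p + F(u)`. With the Caccioppoli inequality
this yields `V(r)^((n-1)/n) + E(r) ≤ C (X(r+5) - X(r))`, which is
`exists_volume_rpow_add_lintegral_le`.

As `V` is bounded below by `μ₂`, the left side dominates a multiple of `X^((n-1)/n)`, and this
discrete differential inequality forces `X(r) ≥ d r^n` for large `r`. By (i) the share of `E` is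
only `O(r^(n-1))`, so `V` itself has growth `r^n`. Sublevel sets follow by the reflection `u ↦ -u`.
-/

namespace TracePhase

/-! ### Gradients of Lipschitz functions along lines and under composition. -/

section Slope

variable {E : Type*} [NormedAddCommGroup E] [NormedSpace ℝ E]

open Classical in
/-- The norm of the gradient of a `K`-Lipschitz function, with the value `K` at the points where the
function is not differentiable. -/
noncomputable def slopeBound (K : ℝ≥0) (w : E → ℝ) (x : E) : ℝ≥0∞ :=
  if DifferentiableAt ℝ w x then ‖fderiv ℝ w x‖ₑ else K

theorem measurable_slopeBound [MeasurableSpace E] [OpensMeasurableSpace E] [CompleteSpace E]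
    (K : ℝ≥0) (w : E → ℝ) : Measurable (slopeBound K w) :=
  Measurable.ite (measurableSet_of_differentiableAt ℝ w) (measurable_fderiv ℝ w).enorm
    measurable_const

theorem slopeBound_ae_eq [FiniteDimensional ℝ E] [MeasurableSpace E] [BorelSpace E]
    {μ : Measure E} [μ.IsAddHaarMeasure] {K : ℝ≥0} {w : E → ℝ} (hw : LipschitzWith K w) :
    ∀ᵐ x ∂μ, slopeBound K w x = ‖fderiv ℝ w x‖ₑ := by
  filter_upwards [hw.ae_differentiableAt (μ := μ)] with x hx
  simp [slopeBound, hx]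

/-- This holds on every line, not just almost every one. A single line is a null set on which `w`
may be nowhere differentiable, and `fderiv` would then be `0`; the value `K` of `slopeBound` keeps
the fundamental theorem of calculus usable there. -/
theorem enorm_sub_le_lintegral_slopeBound {K : ℝ≥0} {w : E → ℝ} (hw : LipschitzWith K w)
    {γ : ℝ → E} {e : E} (hγ : ∀ t, HasDerivAt γ e t) (he : ‖e‖ ≤ 1) {a b : ℝ} (hab : a ≤ b) :
    ‖w (γ b) - w (γ a)‖ₑ ≤ ∫⁻ t in Ioc a b, slopeBound K w (γ t) := by
  have hγL : LipschitzWith 1 γ :=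
    lipschitzWith_of_nnnorm_deriv_le (fun t => (hγ t).differentiableAt) fun t => by
      rw [(hγ t).deriv]; exact_mod_cast he
  have hL : LipschitzWith K (w ∘ γ) := by simpa using hw.comp hγL
  have h1 := (hL.lipschitzOnWith (s := uIcc a b)).absolutelyContinuousOnInterval.integral_deriv_eq_sub
  have h2 : w (γ b) - w (γ a) = ∫ t in Ioc a b, deriv (w ∘ γ) t := by
    rw [← intervalIntegral.integral_of_le hab, h1]; rfl
  rw [h2]
  refine (enorm_integral_le_lintegral_enorm _).trans (lintegral_mono fun t => ?_)
  unfold slopeBound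
  split_ifs with hd
  · have h3 : HasDerivAt (w ∘ γ) (fderiv ℝ w (γ t) e) t :=
      hd.hasFDerivAt.comp_hasDerivAt t (hγ t)
    rw [h3.deriv]
    refine (ContinuousLinearMap.le_opENorm _ _).trans ?_
    calc ‖fderiv ℝ w (γ t)‖ₑ * ‖e‖ₑ ≤ ‖fderiv ℝ w (γ t)‖ₑ * 1 := by
          gcongr
          rw [← ofReal_norm]
          exact ENNReal.ofReal_le_one.2 he
      _ = _ := mul_one _
  · have := norm_deriv_le_of_lipschitz (x₀ := t) hL
    rw [← ofReal_norm]
    exact ENNReal.ofReal_le_of_le_toReal (by simpa using this)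

/-- The chain rule bound `|∇(ψ ∘ u)| ≤ Lip(ψ) |∇u|`. -/
theorem norm_fderiv_comp_le {u : E → ℝ} {x : E} (hu : DifferentiableAt ℝ u x) {ψ : ℝ → ℝ}
    {K : ℝ≥0} (hψ : LipschitzWith K ψ) :
    ‖fderiv ℝ (fun y => ψ (u y)) x‖ ≤ K * ‖fderiv ℝ u x‖ := by
  by_cases hd : DifferentiableAt ℝ (fun y => ψ (u y)) x
  swap
  · rw [fderiv_zero_of_not_differentiableAt hd, norm_zero]; positivity
  -- `ψ` need not be differentiable at `u x`, so the norm is bounded by a local Lipschitz estimate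
  -- of the composite with an arbitrarily small loss.
  refine le_of_forall_pos_le_add fun ε hε => ?_
  obtain ⟨δ, hδ, hKδ⟩ : ∃ δ : ℝ, 0 < δ ∧ K * δ ≤ ε := by
    refine ⟨ε / (K + 1), by positivity, ?_⟩
    rw [mul_div_assoc', div_le_iff₀ (by positivity)]
    nlinarith [K.coe_nonneg]
  have : ‖fderiv ℝ (fun y => ψ (u y)) x‖ ≤ K * (‖fderiv ℝ u x‖ + δ) := by
    refine hd.hasFDerivAt.le_of_lip' (by positivity) ?_
    filter_upwards [hu.hasFDerivAt.isLittleO.bound hδ] with y hy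
    calc ‖ψ (u y) - ψ (u x)‖ ≤ K * ‖u y - u x‖ := by
          simpa [dist_eq_norm] using hψ.dist_le_mul (u y) (u x)
      _ ≤ K * ((‖fderiv ℝ u x‖ + δ) * ‖y - x‖) := by
          gcongr
          have h1 : ‖u y - u x‖ ≤ ‖u y - u x - fderiv ℝ u x (y - x)‖ + ‖fderiv ℝ u x (y - x)‖ := by
            simpa using norm_add_le (u y - u x - fderiv ℝ u x (y - x)) (fderiv ℝ u x (y - x))
          have h2 := (fderiv ℝ u x).le_opNorm (y - x)
          linarith
      _ = _ := by ring
  linarith [mul_add (K : ℝ) ‖fderiv ℝ u x‖ δ]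

end Slope

/-! ### Sobolev inequality in the half-space. -/

section HalfSpace

variable {m : ℕ}

theorem isOpen_halfSpace : IsOpen (halfSpace m) :=
  isOpen_lt continuous_const (by fun_prop)

theorem measurableSet_halfSpace : MeasurableSet (halfSpace m) :=
  isOpen_halfSpace.measurableSet

theorem hasDerivAt_toLp_update (y : Fin (m + 1) → ℝ) (i : Fin (m + 1)) (t : ℝ) :
    HasDerivAt (fun s : ℝ => (WithLp.toLp 2 (Function.update y i s) : Space (m + 1)))
      (EuclideanSpace.single i 1) t := by
  have h : (fun s : ℝ => (WithLp.toLp 2 (Function.update y i s) : Space (m + 1))) =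
      fun s => WithLp.toLp 2 y + (s - y i) • EuclideanSpace.single i (1 : ℝ) := by
    funext s
    ext j
    by_cases hj : j = i
    · subst hj; simp
    · simp [hj]
  rw [h]
  have := (((hasDerivAt_id t).sub_const (y i)).smul_const
    (EuclideanSpace.single i (1 : ℝ))).const_add (WithLp.toLp 2 y)
  simpa using this

/-- Gagliardo–Nirenberg–Sobolev inequality in the half-space, for Lipschitz functions which vanish
outside of a ball (and not necessarily on the boundary hyperplane). -/
theorem lintegral_halfSpace_rpow_le (hm : 1 ≤ m) {K : ℝ≥0} {w : Space (m + 1) → ℝ}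
    (hw : LipschitzWith K w) {x₀ : Space (m + 1)} {R : ℝ}
    (hsupp : ∀ x, x ∉ Metric.ball x₀ R → w x = 0) :
    ∫⁻ x in halfSpace m, ‖w x‖ₑ ^ ((m + 1 : ℝ) / m) ≤
      (∫⁻ x in halfSpace m, ‖fderiv ℝ w x‖ₑ) ^ ((m + 1 : ℝ) / m) := by
  have hm0 : (0 : ℝ) < m := by exact_mod_cast hm
  set f : (Fin (m + 1) → ℝ) → ℝ≥0∞ := fun y =>
    (halfSpace m).indicator (slopeBound K w) (WithLp.toLp 2 y) with hf_def
  have hmp := PiLp.volume_preserving_toLp (Fin (m + 1))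
  have hfm : Measurable f :=
    ((measurable_slopeBound K w).indicator measurableSet_halfSpace).comp hmp.measurable
  have hconj : Real.HolderConjugate (Fintype.card (Fin (m + 1))) ((m + 1 : ℝ) / m) := by
    rw [Real.holderConjugate_iff]
    simp only [Fintype.card_fin, Nat.cast_add, Nat.cast_one]
    refine ⟨by linarith, ?_⟩
    field_simp
    ring
  have key := lintegral_prod_lintegral_pow_le (fun _ : Fin (m + 1) => (volume : Measure ℝ)) hconj hfm
  have hR : ∫⁻ y, f y ∂(Measure.pi fun _ => volume) = ∫⁻ x in halfSpace m, ‖fderiv ℝ w x‖ₑ := by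
    rw [← volume_pi, hmp.lintegral_comp ((measurable_slopeBound K w).indicator
      measurableSet_halfSpace), lintegral_indicator measurableSet_halfSpace]
    exact lintegral_congr_ae (ae_restrict_of_ae (slopeBound_ae_eq hw))
  rw [hR] at key
  refine le_trans ?_ key
  rw [← lintegral_indicator measurableSet_halfSpace, ← hmp.lintegral_comp (by
    exact (hw.continuous.measurable.enorm.pow_const _).indicator measurableSet_halfSpace), volume_pi]
  refine lintegral_mono fun y => ?_
  by_cases hy : (WithLp.toLp 2 y : Space (m + 1)) ∈ halfSpace m
  swap
  · rw [indicator_of_notMem hy]; exact zero_le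
  rw [indicator_of_mem hy]
  -- Integrate from the point in the positive direction of each axis until the ball is left. Such
  -- rays never leave the half-space, hence no boundary term arises. The grid-line inequality `key`
  -- does the rest.
  have hi : ∀ i, ‖w (WithLp.toLp 2 y)‖ₑ ≤ ∫⁻ t, f (Function.update y i t) := by
    intro i
    set T := max (y i) (x₀ i + R)
    have hT : w (WithLp.toLp 2 (Function.update y i T)) = 0 := by
      refine hsupp _ fun hmem => ?_
      have h1 := PiLp.norm_apply_le (WithLp.toLp 2 (Function.update y i T) - x₀) i
      rw [mem_ball_iff_norm] at hmem
      have h2 : x₀ i + R ≤ T := le_max_right _ _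
      have h3 : |T - x₀ i| < R := by simpa using h1.trans_lt hmem
      linarith [(abs_lt.1 h3).2]
    have h := enorm_sub_le_lintegral_slopeBound hw (hasDerivAt_toLp_update y i)
      (by simp) (le_max_left (y i) (x₀ i + R))
    rw [hT, Function.update_eq_self, zero_sub, enorm_neg] at h
    refine h.trans ?_
    rw [← lintegral_indicator measurableSet_Ioc]
    refine lintegral_mono fun t => ?_
    by_cases ht : t ∈ Ioc (y i) (max (y i) (x₀ i + R))
    · rw [indicator_of_mem ht]
      simp only [hf_def]
      rw [indicator_of_mem]
      change 0 < Function.update y i t (Fin.last m)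
      have hy' : 0 < y (Fin.last m) := hy
      by_cases hl : Fin.last m = i
      · subst hl
        rw [Function.update_self]
        exact hy'.trans ht.1
      · rwa [Function.update_of_ne hl]
    · rw [indicator_of_notMem ht]; exact zero_le
  calc ‖w (WithLp.toLp 2 y)‖ₑ ^ ((m + 1 : ℝ) / m)
      = ∏ _i : Fin (m + 1), ‖w (WithLp.toLp 2 y)‖ₑ ^ (1 / (m : ℝ)) := by
        rw [Finset.prod_const, Finset.card_univ, Fintype.card_fin, ← ENNReal.rpow_natCast,
          ← ENNReal.rpow_mul]
        congr 1
        push_cast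
        ring
    _ ≤ _ := by
        refine Finset.prod_le_prod' fun i _ => ?_
        have : ((Fintype.card (Fin (m + 1)) : ℝ) - 1) = m := by simp
        rw [this]
        exact ENNReal.rpow_le_rpow (hi i) (by positivity)

/-! ### Vertical lines and the trace inequality. -/

/-- The point `(x', t)`. -/
def lift (x' : Space m) (t : ℝ) : Space (m + 1) :=
  WithLp.toLp 2 (Fin.snoc (α := fun _ => ℝ) (fun i => x' i) t)

theorem lift_zero (x' : Space m) : lift x' 0 = toHyperplane x' := rfl

@[simp]
theorem lift_last (x' : Space m) (t : ℝ) : lift x' t (Fin.last m) = t := by simp [lift]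

theorem lift_sub_lift (x' : Space m) (s t : ℝ) :
    lift x' s - lift x' t = EuclideanSpace.single (Fin.last m) (s - t) := by
  ext j
  refine Fin.lastCases ?_ (fun i => ?_) j
  · simp [lift]
  · simp [lift]

theorem dist_lift (x' : Space m) (s t : ℝ) : dist (lift x' s) (lift x' t) = |s - t| := by
  rw [dist_eq_norm, lift_sub_lift]; simp

theorem hasDerivAt_lift (x' : Space m) (t : ℝ) :
    HasDerivAt (lift x') (EuclideanSpace.single (Fin.last m) 1) t := by
  have h : lift x' = fun s => lift x' 0 + s • EuclideanSpace.single (Fin.last m) (1 : ℝ) := by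
    funext s
    rw [← sub_eq_iff_eq_add', lift_sub_lift]
    ext j
    simp
  rw [h]
  simpa using ((hasDerivAt_id t).smul_const
    (EuclideanSpace.single (Fin.last m) (1 : ℝ))).const_add (lift x' 0)

theorem measurePreserving_lift :
    MeasurePreserving (fun z : ℝ × Space m => lift z.2 z.1)
      ((volume : Measure ℝ).prod volume) volume := by
  have h1 := (volume_preserving_piFinSuccAbove (fun _ : Fin (m + 1) => ℝ) (Fin.last m)).symm
  have h2 := PiLp.volume_preserving_toLp (Fin (m + 1))
  have h3 : MeasurePreserving (Prod.map (id : ℝ → ℝ) (WithLp.ofLp : Space m → (Fin m → ℝ)))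
      (volume.prod volume) (volume.prod volume) :=
    (MeasurePreserving.id volume).prod (PiLp.volume_preserving_ofLp (Fin m))
  have h4 := h2.comp (h1.comp h3)
  have h5 : (fun z : ℝ × Space m => lift z.2 z.1) = WithLp.toLp 2 ∘
      (MeasurableEquiv.piFinSuccAbove (fun _ : Fin (m + 1) => ℝ) (Fin.last m)).symm ∘
        Prod.map (id : ℝ → ℝ) (WithLp.ofLp : Space m → (Fin m → ℝ)) := by
    funext z
    simp only [Function.comp, lift, MeasurableEquiv.piFinSuccAbove, Prod.map]
    congr 1
    simp [Fin.insertNthEquiv]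
  rw [h5]
  exact h4

theorem rpow_lintegral_le_lintegral_rpow {α : Type*} [MeasurableSpace α] {μ : Measure α}
    [IsProbabilityMeasure μ] {f : α → ℝ≥0∞} (hf : AEMeasurable f μ) {p : ℝ} (hp : 1 ≤ p) :
    (∫⁻ a, f a ∂μ) ^ p ≤ ∫⁻ a, f a ^ p ∂μ := by
  have hp0 : 0 < p := by linarith
  have h := eLpNorm'_le_eLpNorm'_of_exponent_le one_pos hp μ hf.aestronglyMeasurable
  simp only [eLpNorm', enorm_eq_self, ENNReal.rpow_one, one_div, inv_one] at h
  calc _ ≤ ((∫⁻ a, f a ^ p ∂μ) ^ p⁻¹) ^ p := ENNReal.rpow_le_rpow h hp0.le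
    _ = _ := by rw [← ENNReal.rpow_mul, inv_mul_cancel₀ hp0.ne', ENNReal.rpow_one]

/-- Trace inequality on the hyperplane: the trace of `f` over `S` is controlled in `L^p` by `f` and
its gradient on the unit vertical cylinder over `S`. -/
theorem lintegral_trace_rpow_le {p : ℝ} (hp : 1 ≤ p) {K : ℝ≥0} {f : Space (m + 1) → ℝ}
    (hf : LipschitzWith K f) {S : Set (Space m)} (hS : MeasurableSet S) {T : Set (Space (m + 1))}
    (hT : MeasurableSet T) (hST : ∀ x' ∈ S, ∀ t ∈ Ioc (0 : ℝ) 1, lift x' t ∈ T) :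
    ∫⁻ x' in S, ‖f (toHyperplane x')‖ₑ ^ p ≤
      ∫⁻ x in T, (‖f x‖ₑ + ‖fderiv ℝ f x‖ₑ) ^ p := by
  set g : Space (m + 1) → ℝ≥0∞ := fun x => (‖f x‖ₑ + slopeBound K f x) ^ p with hg
  have hsm := measurable_slopeBound K f
  have hgm : Measurable g := (hf.continuous.measurable.enorm.add hsm).pow_const _
  have hlift : ∀ x' : Space m, Continuous (lift x') := fun x' =>
    continuous_iff_continuousAt.2 fun t => (hasDerivAt_lift x' t).continuousAt
  have : IsProbabilityMeasure ((volume : Measure ℝ).restrict (Ioc 0 1)) := ⟨by simp⟩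
  have hpt : ∀ x', ‖f (toHyperplane x')‖ₑ ^ p ≤ ∫⁻ t in Ioc (0 : ℝ) 1, g (lift x' t) := by
    intro x'
    have h0 : ‖f (toHyperplane x')‖ₑ ≤
        ∫⁻ t in Ioc (0 : ℝ) 1, (‖f (lift x' t)‖ₑ + slopeBound K f (lift x' t)) := by
      have hsl : Measurable fun t => slopeBound K f (lift x' t) := hsm.comp (hlift x').measurable
      rw [lintegral_add_right _ hsl]
      set A := ∫⁻ t in Ioc (0 : ℝ) 1, slopeBound K f (lift x' t)
      -- The boundary value is compared with the value at each height `t` and then averaged over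
      -- `(0, 1]`; Jensen's inequality supplies the power `p`.
      have h1 : ∀ t ∈ Ioc (0 : ℝ) 1, ‖f (toHyperplane x')‖ₑ ≤ ‖f (lift x' t)‖ₑ + A := by
        intro t ht
        have h2 := enorm_sub_le_lintegral_slopeBound hf (hasDerivAt_lift x') (by simp) ht.1.le
        have h3 : ∫⁻ s in Ioc 0 t, slopeBound K f (lift x' s) ≤ A :=
          lintegral_mono_set (Ioc_subset_Ioc_right ht.2)
        calc ‖f (toHyperplane x')‖ₑ
            = ‖f (lift x' t) - (f (lift x' t) - f (lift x' 0))‖ₑ := by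
              rw [sub_sub_cancel, lift_zero]
          _ ≤ ‖f (lift x' t)‖ₑ + ‖f (lift x' t) - f (lift x' 0)‖ₑ := enorm_sub_le
          _ ≤ _ := by gcongr; exact h2.trans h3
      calc ‖f (toHyperplane x')‖ₑ = ∫⁻ _ in Ioc (0 : ℝ) 1, ‖f (toHyperplane x')‖ₑ := by simp
        _ ≤ ∫⁻ t in Ioc (0 : ℝ) 1, (‖f (lift x' t)‖ₑ + A) :=
          setLIntegral_mono' measurableSet_Ioc h1
        _ = _ := by
          rw [lintegral_add_right _ measurable_const]; simp
    refine (ENNReal.rpow_le_rpow h0 (by linarith)).trans ?_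
    exact rpow_lintegral_le_lintegral_rpow
      (((hf.continuous.comp (hlift x')).measurable.enorm.add
        (hsm.comp (hlift x').measurable)).aemeasurable) hp
  calc ∫⁻ x' in S, ‖f (toHyperplane x')‖ₑ ^ p
      ≤ ∫⁻ x' in S, ∫⁻ t in Ioc (0 : ℝ) 1, g (lift x' t) := lintegral_mono hpt
    _ ≤ ∫⁻ x', ∫⁻ t, T.indicator g (lift x' t) := by
        rw [← lintegral_indicator hS]
        refine lintegral_mono fun x' => ?_
        by_cases hx : x' ∈ S
        · rw [indicator_of_mem hx, ← lintegral_indicator measurableSet_Ioc]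
          refine lintegral_mono fun t => ?_
          by_cases ht : t ∈ Ioc (0 : ℝ) 1
          · rw [indicator_of_mem ht, indicator_of_mem (hST x' hx t ht)]
          · rw [indicator_of_notMem ht]; exact zero_le
        · rw [indicator_of_notMem hx]; exact zero_le
    _ = ∫⁻ x, T.indicator g x := by
        rw [← measurePreserving_lift.lintegral_comp (hgm.indicator hT),
          lintegral_prod_symm (fun z : ℝ × Space m => T.indicator g (lift z.2 z.1))
            ((hgm.indicator hT).comp measurePreserving_lift.measurable).aemeasurable]
    _ = ∫⁻ x in T, g x := lintegral_indicator hT _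
    _ = _ := by
        refine lintegral_congr_ae (ae_restrict_of_ae ?_)
        filter_upwards [slopeBound_ae_eq hf] with x hx
        simp only [hg, hx]

end HalfSpace

theorem lipschitzWith_mul_of_bounded {α : Type*} [PseudoMetricSpace α] {f g : α → ℝ}
    {K K' M M' : ℝ≥0} (hf : LipschitzWith K f) (hg : LipschitzWith K' g) (hfM : ∀ x, |f x| ≤ M)
    (hgM : ∀ x, |g x| ≤ M') : LipschitzWith (K * M' + M * K') fun x => f x * g x := by
  refine LipschitzWith.of_dist_le_mul fun x y => ?_
  have h1 := hf.dist_le_mul x y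
  have h2 := hg.dist_le_mul x y
  rw [Real.dist_eq] at *
  push_cast
  calc |f x * g x - f y * g y| = |(f x - f y) * g x + f y * (g x - g y)| := by ring_nf
    _ ≤ |f x - f y| * |g x| + |f y| * |g x - g y| := by
      rw [← abs_mul, ← abs_mul]; exact abs_add_le _ _
    _ ≤ (K * dist x y) * M' + M * (K' * dist x y) := by
      gcongr
      exacts [hgM x, hfM y]
    _ = _ := by ring

/-! ### Radial cutoffs. -/

section Cutoff

variable {E : Type*} [NormedAddCommGroup E]

/-- The `1`-Lipschitz cutoff which is `1` on the ball of radius `r` and vanishes outside of the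
ball of radius `r + 1`. -/
noncomputable def cutoff (x₀ : E) (r : ℝ) (x : E) : ℝ := max 0 (min 1 (r + 1 - dist x x₀))

theorem cutoff_nonneg (x₀ : E) (r : ℝ) (x : E) : 0 ≤ cutoff x₀ r x := le_max_left _ _

theorem cutoff_le_one (x₀ : E) (r : ℝ) (x : E) : cutoff x₀ r x ≤ 1 :=
  max_le zero_le_one (min_le_left _ _)

theorem cutoff_eq_one {x₀ x : E} {r : ℝ} (h : dist x x₀ ≤ r) : cutoff x₀ r x = 1 := by
  rw [cutoff, min_eq_left (by linarith), max_eq_right zero_le_one]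

theorem cutoff_eq_zero {x₀ x : E} {r : ℝ} (h : r + 1 ≤ dist x x₀) : cutoff x₀ r x = 0 := by
  rw [cutoff, max_eq_left ((min_le_right _ _).trans (by linarith))]

theorem lipschitzWith_cutoff (x₀ : E) (r : ℝ) : LipschitzWith 1 (cutoff x₀ r) := by
  have h : LipschitzWith 1 fun x : E => r + 1 - dist x x₀ := by
    refine LipschitzWith.of_dist_le_mul fun x y => ?_
    rw [Real.dist_eq, NNReal.coe_one, one_mul]
    have := abs_dist_sub_le y x x₀
    rw [dist_comm y x] at this
    convert this using 2
    ring
  exact (h.const_min 1).const_max 0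

theorem fderiv_cutoff_of_lt [NormedSpace ℝ E] {x₀ x : E} {r : ℝ} (h : dist x x₀ < r) :
    fderiv ℝ (cutoff x₀ r) x = 0 := by
  have : cutoff x₀ r =ᶠ[nhds x] fun _ => 1 := by
    filter_upwards [Metric.isOpen_ball.mem_nhds (Metric.mem_ball.2 h)] with y hy
    exact cutoff_eq_one (Metric.mem_ball.1 hy).le
  rw [this.fderiv_eq]
  simp

theorem fderiv_cutoff_of_gt [NormedSpace ℝ E] {x₀ x : E} {r : ℝ} (h : r + 1 < dist x x₀) :
    fderiv ℝ (cutoff x₀ r) x = 0 := by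
  have : cutoff x₀ r =ᶠ[nhds x] fun _ => 0 := by
    have ho : IsOpen {y : E | r + 1 < dist y x₀} := isOpen_lt continuous_const (by fun_prop)
    filter_upwards [ho.mem_nhds h] with y hy
    exact cutoff_eq_zero (le_of_lt hy)
  rw [this.fderiv_eq]
  simp

end Cutoff

/-! ### Caccioppoli inequality and energy growth. -/

section Energy

variable {m : ℕ} {p Q C₀ : ℝ} {F G : ℝ → ℝ} {u : Space (m + 1) → ℝ}

theorem continuous_toHyperplane : Continuous (toHyperplane : Space m → Space (m + 1)) := by
  have : Isometry (toHyperplane : Space m → Space (m + 1)) := by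
    refine Isometry.of_dist_eq fun x y => ?_
    simp [EuclideanSpace.dist_eq, Fin.sum_univ_castSucc, toHyperplane]
  exact this.continuous

theorem energy_mono {Ω Ω' : Set (Space (m + 1))} (h : Ω ⊆ Ω') :
    energy p F G Ω u ≤ energy p F G Ω' u :=
  add_le_add (lintegral_mono_set (inter_subset_inter_left _ h))
    (lintegral_mono_set (preimage_mono h))

/-- Factor `1 - τ² = (1 - τ)(1 + τ) ≤ 2 (1 + τ)`. The slack in `s` allows the potentials of the
competitor to be bounded by quantities of `u`. -/
theorem IsDoubleWell.le_one_add (hW : IsDoubleWell p C₀ F G) (hp : 0 ≤ p) (hC₀ : 0 ≤ C₀) {τ s : ℝ}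
    (hτ : τ ∈ Icc (-1 : ℝ) 1) (hs : 1 + τ ≤ s) :
    F τ ≤ C₀ * 2 ^ p * s ^ p ∧ G τ ≤ C₀ * 2 ^ p * s ^ p := by
  have h : C₀ * (1 - τ ^ 2) ^ p ≤ C₀ * 2 ^ p * s ^ p := by
    rw [mul_assoc, ← Real.mul_rpow (by norm_num) (by linarith [hτ.1])]
    gcongr
    · nlinarith [hτ.1, hτ.2]
    · nlinarith [hτ.1, hτ.2]
  have := hW.upper τ hτ
  exact ⟨(le_max_left _ _).trans (this.trans h), (le_max_right _ _).trans (this.trans h)⟩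

theorem IsDoubleWell.apply_neg_one (hW : IsDoubleWell p C₀ F G) (hp : 0 < p) :
    F (-1) = 0 ∧ G (-1) = 0 := by
  have h1 : (-1 : ℝ) ∈ Icc (-1 : ℝ) 1 := by norm_num
  have h2 := hW.upper _ h1
  have h3 := hW.nonneg _ h1
  norm_num [Real.zero_rpow hp.ne'] at h2
  exact ⟨le_antisymm h2.1 h3.1, le_antisymm h2.2 h3.2⟩

/-- The function `1 + u` multiplied by one minus a cutoff is an admissible competitor. -/
theorem energy_ball_le_energy_competitor {L : ℝ≥0} (hL : LipschitzWith L u)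
    (hu : IsQMinimizer p Q F G u) (x₀ : Space (m + 1)) (r : ℝ) :
    energy p F G (Metric.ball x₀ (r + 2)) u ≤ ENNReal.ofReal Q *
      energy p F G (Metric.ball x₀ (r + 2)) (fun x => u x + -((1 + u x) * cutoff x₀ r x)) := by
  refine hu.energy_le _ Metric.isOpen_ball Metric.isBounded_ball _
    ⟨(L * 1 + 2 * 1), ?_⟩ ?_ ?_
  · have h1 : LipschitzWith L fun x => 1 + u x := by
      simpa using (LipschitzWith.const (1 : ℝ)).add hL
    refine (lipschitzWith_mul_of_bounded h1 (lipschitzWith_cutoff x₀ r) (M := 2) (M' := 1)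
      (fun x => ?_) fun x => ?_).neg
    · have := hu.mem_Icc x
      rw [abs_of_nonneg (by linarith [this.1])]
      push_cast
      linarith [this.2]
    · rw [abs_of_nonneg (cutoff_nonneg _ _ _)]
      exact cutoff_le_one _ _ _
  · have h1 : tsupport (fun x => -((1 + u x) * cutoff x₀ r x)) ⊆ Metric.closedBall x₀ (r + 1) := by
      refine closure_minimal (fun x hx => ?_) Metric.isClosed_closedBall
      by_contra hx'
      refine hx ?_
      have : r + 1 ≤ dist x x₀ := le_of_lt (by simpa using hx')
      simp [cutoff_eq_zero this]
    exact h1.trans (Metric.closedBall_subset_ball (by linarith))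
  · intro x
    have h1 := hu.mem_Icc x
    have h2 := cutoff_nonneg x₀ r x
    have h3 := cutoff_le_one x₀ r x
    constructor <;> nlinarith [h1.1, h1.2]

/-- With `ζ` the cutoff, the gradient is `(1 - ζ) ∇u - (1 + u) ∇ζ`, where `0 ≤ ζ ≤ 1` and `|∇ζ| ≤
1`. -/
theorem norm_fderiv_competitor_le {x₀ x : Space (m + 1)} {r : ℝ} (hux : -1 ≤ u x)
    (hd : DifferentiableAt ℝ u x) (hd' : DifferentiableAt ℝ (cutoff x₀ r) x) :
    ‖fderiv ℝ (fun y => u y + -((1 + u y) * cutoff x₀ r y)) x‖ ≤ 1 + u x + ‖fderiv ℝ u x‖ := by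
  have h := hd.hasFDerivAt.add ((hd.hasFDerivAt.const_add 1).mul hd'.hasFDerivAt).neg
  have h' : HasFDerivAt (fun y => u y + -((1 + u y) * cutoff x₀ r y))
      ((1 - cutoff x₀ r x) • fderiv ℝ u x - (1 + u x) • fderiv ℝ (cutoff x₀ r) x) x := by
    refine h.congr_fderiv ?_
    module
  rw [h'.fderiv]
  have h2 := cutoff_nonneg x₀ r x
  have h3 := cutoff_le_one x₀ r x
  have h4 : ‖fderiv ℝ (cutoff x₀ r) x‖ ≤ 1 :=
    norm_fderiv_le_of_lipschitz ℝ (lipschitzWith_cutoff x₀ r)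
  calc _ ≤ ‖(1 - cutoff x₀ r x) • fderiv ℝ u x‖ + ‖(1 + u x) • fderiv ℝ (cutoff x₀ r) x‖ :=
        norm_sub_le _ _
    _ = (1 - cutoff x₀ r x) * ‖fderiv ℝ u x‖ + (1 + u x) * ‖fderiv ℝ (cutoff x₀ r) x‖ := by
        rw [norm_smul, norm_smul, Real.norm_of_nonneg (by linarith),
          Real.norm_of_nonneg (by linarith)]
    _ ≤ 1 * ‖fderiv ℝ u x‖ + (1 + u x) * 1 := by
        gcongr
        · linarith
        · linarith
    _ = _ := by ring

/-- A Caccioppoli type inequality: the energy in a ball is controlled by `1 + u` and its gradient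
in an annulus. -/
theorem energy_ball_le_lintegral_annulus (hp : 1 < p) (hQ : 1 ≤ Q) (hC₀ : 1 ≤ C₀) {L : ℝ≥0}
    (hW : IsDoubleWell p C₀ F G) (hL : LipschitzWith L u) (hu : IsQMinimizer p Q F G u)
    (x₀ : Space (m + 1)) (r : ℝ) :
    energy p F G (Metric.ball x₀ r) u ≤ ENNReal.ofReal (Q * (1 + 2 * (C₀ * 2 ^ p))) *
      ∫⁻ x in (Metric.ball x₀ (r + 3) \ Metric.ball x₀ (r - 1)) ∩ halfSpace m,
        ENNReal.ofReal ((1 + u x + ‖fderiv ℝ u x‖) ^ p) := by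
  have hp0 : 0 < p := by linarith
  have hC₀' : 0 ≤ C₀ := by linarith
  have hQ' : 0 ≤ Q := by linarith
  set T := (Metric.ball x₀ (r + 3) \ Metric.ball x₀ (r - 1)) ∩ halfSpace m with hT_def
  have hT : MeasurableSet T :=
    (Metric.isOpen_ball.measurableSet.diff Metric.isOpen_ball.measurableSet).inter
      measurableSet_halfSpace
  set I := ∫⁻ x in T, ENNReal.ofReal ((1 + u x + ‖fderiv ℝ u x‖) ^ p) with hI
  set v : Space (m + 1) → ℝ := fun x => u x + -((1 + u x) * cutoff x₀ r x) with hv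
  have hvI : ∀ x, v x ∈ Icc (-1 : ℝ) 1 ∧ 1 + v x ≤ 1 + u x := by
    intro x
    have h1 := hu.mem_Icc x
    have h2 := cutoff_nonneg x₀ r x
    have h3 := cutoff_le_one x₀ r x
    refine ⟨⟨?_, ?_⟩, ?_⟩ <;> simp only [hv] <;> nlinarith [h1.1, h1.2]
  have hv1 : ∀ x, dist x x₀ < r → v x = -1 := by
    intro x hx
    simp only [hv, cutoff_eq_one hx.le]
    ring
  have hfu : ∀ x, 0 ≤ 1 + u x := fun x => by linarith [(hu.mem_Icc x).1]
  have hbulk : ∫⁻ x in Metric.ball x₀ (r + 2) ∩ halfSpace m,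
      ENNReal.ofReal (‖fderiv ℝ v x‖ ^ p + F (v x)) ≤
        ENNReal.ofReal (1 + C₀ * 2 ^ p) * I := by
    rw [hI, ← lintegral_const_mul' _ _ ENNReal.ofReal_ne_top, ← lintegral_indicator hT,
      ← lintegral_indicator (Metric.isOpen_ball.measurableSet.inter measurableSet_halfSpace)]
    refine lintegral_mono_ae ?_
    filter_upwards [hL.ae_differentiableAt (μ := volume),
      (lipschitzWith_cutoff x₀ r).ae_differentiableAt (μ := volume)] with x hd hd'
    by_cases hx : x ∈ Metric.ball x₀ (r + 2) ∩ halfSpace m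
    swap
    · rw [indicator_of_notMem hx]; exact zero_le
    rw [indicator_of_mem hx]
    by_cases hxr : dist x x₀ < r
    · have h0 : fderiv ℝ v x = 0 := by
        have : v =ᶠ[nhds x] fun _ => -1 := by
          filter_upwards [Metric.isOpen_ball.mem_nhds (Metric.mem_ball.2 hxr)] with y hy
          exact hv1 y hy
        rw [this.fderiv_eq]; simp
      rw [h0, hv1 x hxr, (hW.apply_neg_one hp0).1, norm_zero, Real.zero_rpow hp0.ne']
      simp
    · have hxT : x ∈ T := by
        refine ⟨⟨?_, ?_⟩, hx.2⟩
        · have := Metric.mem_ball.1 hx.1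
          rw [Metric.mem_ball]; linarith
        · rw [Metric.mem_ball]; linarith
      rw [indicator_of_mem hxT, ← ENNReal.ofReal_mul (by positivity)]
      refine ENNReal.ofReal_le_ofReal ?_
      have h1 := norm_fderiv_competitor_le (hu.mem_Icc x).1 hd hd'
      have h2 := (hW.le_one_add hp0.le hC₀' (hvI x).1 (s := 1 + u x + ‖fderiv ℝ u x‖)
        (by linarith [(hvI x).2, norm_nonneg (fderiv ℝ u x)])).1
      have h3 := Real.rpow_le_rpow (norm_nonneg _) h1 hp0.le
      rw [add_mul, one_mul]
      exact add_le_add h3 h2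
  have hbdry : ∫⁻ x' in {x' : Space m | toHyperplane x' ∈ Metric.ball x₀ (r + 2)},
      ENNReal.ofReal (G (v (toHyperplane x'))) ≤ ENNReal.ofReal (C₀ * 2 ^ p) * I := by
    set S : Set (Space m) := {x' : Space m | toHyperplane x' ∈ Metric.ball x₀ (r + 2)} with hS_def
    have hS : MeasurableSet S := (Metric.isOpen_ball.preimage continuous_toHyperplane).measurableSet
    set S' : Set (Space m) := S \ {x' : Space m | toHyperplane x' ∈ Metric.ball x₀ r} with hS'_def
    have hS' : MeasurableSet S' :=
      hS.diff (Metric.isOpen_ball.preimage continuous_toHyperplane).measurableSet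
    -- Rising by at most `1` changes the distance to `x₀` by at most `1`: this widens the annulus
    -- from radii `r`, `r + 2` to `r - 1`, `r + 3`.
    have htr := lintegral_trace_rpow_le (p := p) hp.le (f := fun x => 1 + u x) (K := L)
      (by simpa using (LipschitzWith.const (1 : ℝ)).add hL) hS' hT (by
        intro x' hx' t ht
        have h1 : dist (lift x' t) (toHyperplane x') ≤ 1 := by
          rw [← lift_zero, dist_lift, sub_zero, abs_of_pos ht.1]; exact ht.2
        have h2 : dist (toHyperplane x') x₀ < r + 2 := hx'.1
        have h3 : r ≤ dist (toHyperplane x') x₀ := not_lt.1 hx'.2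
        refine ⟨⟨?_, ?_⟩, ?_⟩
        · rw [Metric.mem_ball]
          linarith [dist_triangle (lift x' t) (toHyperplane x') x₀]
        · rw [Metric.mem_ball]
          linarith [dist_triangle_left (toHyperplane x') x₀ (lift x' t)]
        · change 0 < lift x' t (Fin.last m)
          rw [lift_last]; exact ht.1)
    have hI' : ∫⁻ x in T, (‖1 + u x‖ₑ + ‖fderiv ℝ (fun x => 1 + u x) x‖ₑ) ^ p = I := by
      refine lintegral_congr fun x => ?_
      rw [fderiv_const_add, ← ofReal_norm, ← ofReal_norm,
        ← ENNReal.ofReal_add (norm_nonneg _) (norm_nonneg _), Real.norm_of_nonneg (hfu x),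
        ENNReal.ofReal_rpow_of_nonneg (add_nonneg (hfu x) (norm_nonneg _)) hp0.le]
    rw [hI'] at htr
    refine le_trans ?_ (mul_le_mul_right htr _)
    rw [← lintegral_const_mul' _ _ ENNReal.ofReal_ne_top, ← lintegral_indicator hS,
      ← lintegral_indicator hS']
    refine lintegral_mono fun x' => ?_
    by_cases hx : x' ∈ S
    swap
    · rw [indicator_of_notMem hx]; exact zero_le
    rw [indicator_of_mem hx]
    by_cases hxr : dist (toHyperplane x') x₀ < r
    · rw [hv1 _ hxr, (hW.apply_neg_one hp0).2]
      simp
    · have hxS : x' ∈ S' := ⟨hx, hxr⟩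
      rw [indicator_of_mem hxS, ← ofReal_norm, Real.norm_of_nonneg (hfu _),
        ENNReal.ofReal_rpow_of_nonneg (hfu _) hp0.le, ← ENNReal.ofReal_mul (by positivity)]
      exact ENNReal.ofReal_le_ofReal (hW.le_one_add hp0.le hC₀' (hvI _).1 (hvI _).2).2
  calc energy p F G (Metric.ball x₀ r) u ≤ energy p F G (Metric.ball x₀ (r + 2)) u :=
        energy_mono (Metric.ball_subset_ball (by linarith))
    _ ≤ ENNReal.ofReal Q * energy p F G (Metric.ball x₀ (r + 2)) v :=
        energy_ball_le_energy_competitor hL hu x₀ r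
    _ ≤ ENNReal.ofReal Q * (ENNReal.ofReal (1 + C₀ * 2 ^ p) * I + ENNReal.ofReal (C₀ * 2 ^ p) * I) :=
        mul_le_mul_right (add_le_add hbulk hbdry) _
    _ = _ := by
        rw [← add_mul, ← ENNReal.ofReal_add (by positivity) (by positivity), ← mul_assoc,
          ← ENNReal.ofReal_mul hQ']
        congr 3
        ring

/-- A mean value bound for powers, serving both the volume of annuli and the discrete growth
argument. -/
theorem pow_succ_sub_pow_succ_le {a b : ℝ} (ha : 0 ≤ a) (hab : a ≤ b) (k : ℕ) :
    b ^ (k + 1) - a ^ (k + 1) ≤ (k + 1) * (b - a) * b ^ k := by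
  induction k with
  | zero => simp
  | succ k ih =>
    have h1 : a ^ (k + 1) ≤ b ^ (k + 1) := by gcongr
    have h2 : 0 ≤ b - a := by linarith
    have h3 : 0 ≤ b := by linarith
    calc b ^ (k + 1 + 1) - a ^ (k + 1 + 1)
        = b * (b ^ (k + 1) - a ^ (k + 1)) + (b - a) * a ^ (k + 1) := by ring
      _ ≤ b * ((k + 1) * (b - a) * b ^ k) + (b - a) * b ^ (k + 1) := by gcongr
      _ = _ := by push_cast; ring

theorem volume_annulus_le (x₀ : Space (m + 1)) {R : ℝ} (hR : 1 ≤ R) :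
    volume (Metric.ball x₀ (R + 3) \ Metric.ball x₀ (R - 1)) ≤
      ENNReal.ofReal ((m + 1) * 4 ^ (m + 1) *
        (volume (Metric.ball (0 : Space (m + 1)) 1)).toReal * R ^ m) := by
  set ω := (volume (Metric.ball (0 : Space (m + 1)) 1)).toReal
  have hω : volume (Metric.ball (0 : Space (m + 1)) 1) = ENNReal.ofReal ω :=
    (ENNReal.ofReal_toReal measure_ball_lt_top.ne).symm
  have hω0 : 0 ≤ ω := ENNReal.toReal_nonneg
  rw [measure_sdiff (Metric.ball_subset_ball (by linarith))
    Metric.isOpen_ball.measurableSet.nullMeasurableSet measure_ball_lt_top.ne,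
    Measure.addHaar_ball _ x₀ (r := R + 3) (by linarith),
    Measure.addHaar_ball _ x₀ (r := R - 1) (by linarith), hω,
    ← ENNReal.ofReal_mul (by positivity), ← ENNReal.ofReal_mul (by
      exact pow_nonneg (by linarith) _),
    ← ENNReal.ofReal_sub _ (mul_nonneg (pow_nonneg (by linarith) _) hω0)]
  refine ENNReal.ofReal_le_ofReal ?_
  rw [← sub_mul]
  have hd : Module.finrank ℝ (Space (m + 1)) = m + 1 := by simp
  rw [hd]
  have h1 := pow_succ_sub_pow_succ_le (a := R - 1) (b := R + 3) (by linarith) (by linarith) m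
  have h2 : (R + 3) ^ m ≤ (4 * R) ^ m := pow_le_pow_left₀ (by linarith) (by linarith) m
  calc ((R + 3) ^ (m + 1) - (R - 1) ^ (m + 1)) * ω
      ≤ ((m + 1) * 4 * (4 * R) ^ m) * ω := by
        refine mul_le_mul_of_nonneg_right (h1.trans ?_) hω0
        have : R + 3 - (R - 1) = 4 := by ring
        rw [this]
        gcongr
    _ = _ := by rw [mul_pow]; ring

/-- The energy of a Lipschitz `Q`-minimizer in a ball of radius `R` grows at most like `R^(n-1)`. -/
theorem exists_energy_ball_le (m : ℕ) (hp : 1 < p) (hQ : 1 ≤ Q) (hC₀ : 1 ≤ C₀) (L : ℝ≥0) :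
    ∃ C : ℝ, 0 < C ∧
      ∀ (F G : ℝ → ℝ) (u : Space (m + 1) → ℝ), IsDoubleWell p C₀ F G →
        LipschitzWith L u → IsQMinimizer p Q F G u →
        ∀ (x₀ : Space (m + 1)) (R : ℝ), 1 ≤ R →
          energy p F G (Metric.ball x₀ R) u ≤ ENNReal.ofReal (C * R ^ m) := by
  have hω : 0 < (volume (Metric.ball (0 : Space (m + 1)) 1)).toReal :=
    ENNReal.toReal_pos (Metric.measure_ball_pos _ _ one_pos).ne' measure_ball_lt_top.ne
  refine ⟨Q * (1 + 2 * (C₀ * 2 ^ p)) * ((2 + L) ^ p * ((m + 1) * 4 ^ (m + 1) *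
        (volume (Metric.ball (0 : Space (m + 1)) 1)).toReal)), by positivity, ?_⟩
  intro F G u hW hL hu x₀ R hR
  refine (energy_ball_le_lintegral_annulus hp hQ hC₀ hW hL hu x₀ R).trans ?_
  have hA : 0 ≤ Q * (1 + 2 * (C₀ * 2 ^ p)) := by positivity
  rw [mul_assoc _ _ (R ^ m), ENNReal.ofReal_mul hA]
  refine mul_le_mul_right (a := ENNReal.ofReal (Q * (1 + 2 * (C₀ * 2 ^ p)))) ?_
  -- Only here does the Lipschitz constant enter the constants.
  calc _ ≤ ∫⁻ x in (Metric.ball x₀ (R + 3) \ Metric.ball x₀ (R - 1)) ∩ halfSpace m,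
        ENNReal.ofReal ((2 + L) ^ p) := by
        refine lintegral_mono fun x => ENNReal.ofReal_le_ofReal ?_
        have h1 := hu.mem_Icc x
        have h2 : ‖fderiv ℝ u x‖ ≤ L := norm_fderiv_le_of_lipschitz ℝ hL
        have h3 := norm_nonneg (fderiv ℝ u x)
        exact Real.rpow_le_rpow (by linarith [h1.1]) (by linarith [h1.2]) (by linarith)
    _ ≤ ENNReal.ofReal ((2 + L) ^ p) * volume (Metric.ball x₀ (R + 3) \ Metric.ball x₀ (R - 1)) := by
        rw [setLIntegral_const]
        exact mul_le_mul_right (measure_mono inter_subset_left) _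
    _ ≤ _ := by
        rw [mul_assoc _ _ (R ^ m), ENNReal.ofReal_mul (by positivity)]
        exact mul_le_mul_right (volume_annulus_le x₀ hR) _

end Energy

/-! ### Isoperimetric inequality for superlevel sets. -/

section Density

variable {m : ℕ} {p Q C₀ θ : ℝ} {F G : ℝ → ℝ} {u : Space (m + 1) → ℝ}

/-- The bulk energy density. -/
noncomputable def bulkDensity (p : ℝ) (F : ℝ → ℝ) (u : Space (m + 1) → ℝ) (x : Space (m + 1)) :
    ℝ≥0∞ :=
  ENNReal.ofReal (‖fderiv ℝ u x‖ ^ p + F (u x))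

/-- The bulk energy density plus the characteristic function of `{θ < u}`. -/
noncomputable def totalDensity (p θ : ℝ) (F : ℝ → ℝ) (u : Space (m + 1) → ℝ) (x : Space (m + 1)) :
    ℝ≥0∞ :=
  bulkDensity p F u x + {x | θ < u x}.indicator 1 x

theorem measurable_bulkDensity (hF : Measurable F) (hu : Measurable u) :
    Measurable (bulkDensity p F u) :=
  (((measurable_fderiv ℝ u).norm.pow_const p).add (hF.comp hu)).ennreal_ofReal

theorem lintegral_bulkDensity_le_energy (x₀ : Space (m + 1)) (r : ℝ) :
    ∫⁻ x in halfBall x₀ r, bulkDensity p F u x ≤ energy p F G (Metric.ball x₀ r) u :=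
  le_self_add

theorem add_rpow_le_two_rpow_mul {a b p : ℝ} (ha : 0 ≤ a) (hb : 0 ≤ b) (hp : 0 ≤ p) :
    (a + b) ^ p ≤ 2 ^ p * (a ^ p + b ^ p) := by
  rcases le_total a b with h | h
  · calc (a + b) ^ p ≤ (2 * b) ^ p := Real.rpow_le_rpow (by positivity) (by linarith) hp
      _ = 2 ^ p * b ^ p := Real.mul_rpow (by norm_num) hb
      _ ≤ _ := by gcongr; linarith [Real.rpow_nonneg ha p]
  · calc (a + b) ^ p ≤ (2 * a) ^ p := Real.rpow_le_rpow (by positivity) (by linarith) hp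
      _ = 2 ^ p * a ^ p := Real.mul_rpow (by norm_num) ha
      _ ≤ _ := by gcongr; linarith [Real.rpow_nonneg hb p]

/-- Elementary bounds on a double well potential, for a constant depending only on `p`, `C₀`
and `θ`. -/
theorem exists_doubleWell_bounds (hp : 1 < p) (hC₀ : 1 ≤ C₀) (hθ : θ ∈ Ioo (-1 : ℝ) 1) :
    ∃ A : ℝ, 1 ≤ A ∧ ∀ F G : ℝ → ℝ, IsDoubleWell p C₀ F G → ∀ τ ∈ Icc (-1 : ℝ) 1, ∀ D : ℝ, 0 ≤ D →
      (1 + τ + D) ^ p ≤ A * (D ^ p + F τ + 1) ∧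
      (τ ≤ θ → (1 + τ + D) ^ p ≤ A * (D ^ p + F τ)) ∧
      ((θ - 1) / 2 ≤ τ → τ ≤ θ → D ≤ A * (D ^ p + F τ) ∧ 1 ≤ A * (D ^ p + F τ)) := by
  obtain ⟨hθ1, hθ2⟩ := hθ
  have hp0 : 0 ≤ p := by linarith
  have hC₀' : 0 < C₀ := by linarith
  have h1θ : 0 < 1 - θ := by linarith
  have h2θ : 0 < 1 + θ := by linarith
  have ha : 0 < (1 - θ) ^ p := by positivity
  -- A lower bound for `F` on `[(θ - 1) / 2, θ]`, whose left end is the midpoint of `-1` and `θ`.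
  -- Below, `B` serves for `(1 + τ)^p ≤ B F(τ)` when `τ ≤ θ`; above `θ` the well at `1` makes the
  -- extra `+ 1` necessary.
  set c := 1 / C₀ * ((1 - θ) * ((1 + θ) / 2)) ^ p with hc_def
  have hc : 0 < c := by positivity
  set B : ℝ := C₀ / (1 - θ) ^ p with hB_def
  have hB : 0 ≤ B := by positivity
  have h2p : (1 : ℝ) ≤ 2 ^ p := Real.one_le_rpow (by norm_num) hp0
  refine ⟨2 ^ p * (2 ^ p + B) + 1 / c + 1, by
    have : 0 ≤ 2 ^ p * (2 ^ p + B) + 1 / c := by positivity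
    linarith, ?_⟩
  intro F G hW τ hτ D hD
  have hF := (hW.nonneg τ hτ).1
  have hDp : 0 ≤ D ^ p := by positivity
  have hτ0 : 0 ≤ 1 + τ := by linarith [hτ.1]
  have hsum := add_rpow_le_two_rpow_mul hτ0 hD hp0
  have hAge : 2 ^ p * (2 ^ p + B) ≤ 2 ^ p * (2 ^ p + B) + 1 / c + 1 := by
    have : 0 ≤ 1 / c := by positivity
    linarith
  have hle : ∀ X : ℝ, 0 ≤ X → 2 ^ p * ((2 ^ p + B) * X) ≤
      (2 ^ p * (2 ^ p + B) + 1 / c + 1) * X := by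
    intro X hX
    rw [← mul_assoc]
    gcongr
  refine ⟨?_, ?_, ?_⟩
  · refine hsum.trans (le_trans ?_ (hle _ (by positivity)))
    gcongr
    have h1 : (1 + τ) ^ p ≤ 2 ^ p := Real.rpow_le_rpow hτ0 (by linarith [hτ.2]) hp0
    nlinarith
  · intro hτθ
    refine hsum.trans (le_trans ?_ (hle _ (by positivity)))
    gcongr
    have h1 : (1 + τ) ^ p ≤ B * F τ := by
      have h2 := hW.lower τ hτ
      have h3 : (1 - θ) ^ p * (1 + τ) ^ p ≤ (1 - τ ^ 2) ^ p := by
        rw [← Real.mul_rpow h1θ.le hτ0]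
        refine Real.rpow_le_rpow (by positivity) ?_ hp0
        nlinarith
      rw [hB_def, div_mul_eq_mul_div, le_div_iff₀ ha]
      rw [one_div, inv_mul_le_iff₀ hC₀'] at h2
      linarith
    nlinarith
  · intro hτ1 hτ2
    have h1 : c ≤ F τ := by
      refine le_trans ?_ (hW.lower τ hτ)
      rw [hc_def]
      gcongr
      nlinarith
    have h2 : 1 ≤ 1 / c * F τ := by
      rw [one_div, ← div_eq_inv_mul, le_div_iff₀ hc]; linarith
    have h3 : 1 / c * F τ + D ^ p ≤ (2 ^ p * (2 ^ p + B) + 1 / c + 1) * (D ^ p + F τ) := by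
      have e1 : 0 ≤ 2 ^ p * (2 ^ p + B) * (D ^ p + F τ) := by positivity
      have e2 : 0 ≤ 1 / c * D ^ p := by positivity
      nlinarith
    refine ⟨?_, by linarith⟩
    rcases le_total D 1 with h | h
    · linarith
    · have : D ≤ D ^ p := by
        simpa using Real.rpow_le_rpow_of_exponent_le h hp.le
      linarith

/-- The `2 / (1 + θ)`-Lipschitz function which is `0` on `(-∞, (θ - 1) / 2]` and `1`
on `[θ, ∞)`. -/
noncomputable def levelCut (θ s : ℝ) : ℝ := max 0 (min 1 ((s - (θ - 1) / 2) * (2 / (1 + θ))))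

theorem levelCut_nonneg (θ s : ℝ) : 0 ≤ levelCut θ s := le_max_left _ _

theorem levelCut_le_one (θ s : ℝ) : levelCut θ s ≤ 1 := max_le zero_le_one (min_le_left _ _)

theorem levelCut_of_le (hθ : -1 < θ) {s : ℝ} (hs : s ≤ (θ - 1) / 2) : levelCut θ s = 0 := by
  have h : (s - (θ - 1) / 2) * (2 / (1 + θ)) ≤ 0 :=
    mul_nonpos_of_nonpos_of_nonneg (by linarith) (div_nonneg (by norm_num) (by linarith))
  rw [levelCut, max_eq_left ((min_le_right _ _).trans h)]

theorem levelCut_of_ge (hθ : -1 < θ) {s : ℝ} (hs : θ ≤ s) : levelCut θ s = 1 := by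
  have h : 1 ≤ (s - (θ - 1) / 2) * (2 / (1 + θ)) := by
    rw [mul_div_assoc', le_div_iff₀ (by linarith)]
    linarith
  rw [levelCut, min_eq_left h, max_eq_right zero_le_one]

theorem lipschitzWith_levelCut (hθ : -1 < θ) :
    LipschitzWith (Real.toNNReal (2 / (1 + θ))) (levelCut θ) := by
  have h0 : 0 ≤ 2 / (1 + θ) := div_nonneg (by norm_num) (by linarith)
  have h : LipschitzWith (Real.toNNReal (2 / (1 + θ)))
      fun s => (s - (θ - 1) / 2) * (2 / (1 + θ)) := by
    refine LipschitzWith.of_dist_le_mul fun x y => ?_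
    rw [Real.dist_eq, Real.dist_eq, Real.coe_toNNReal _ h0, ← sub_mul, abs_mul, abs_of_nonneg h0,
      mul_comm]
    refine le_of_eq ?_
    congr 2
    ring
  exact (h.const_min 1).const_max 0

/-- Confines the gradient of the truncation to the layer where `F` is bounded below. -/
theorem fderiv_levelCut_comp_eq_zero (hθ : -1 < θ) (hu : Continuous u) {x : Space (m + 1)}
    (hx : u x < (θ - 1) / 2 ∨ θ < u x) : fderiv ℝ (fun y => levelCut θ (u y)) x = 0 := by
  rcases hx with hx | hx
  · have : (fun y => levelCut θ (u y)) =ᶠ[nhds x] fun _ => 0 := by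
      filter_upwards [(isOpen_lt hu continuous_const).mem_nhds hx] with y hy
      exact levelCut_of_le hθ (le_of_lt hy)
    rw [this.fderiv_eq]; simp
  · have : (fun y => levelCut θ (u y)) =ᶠ[nhds x] fun _ => 1 := by
      filter_upwards [(isOpen_lt continuous_const hu).mem_nhds hx] with y hy
      exact levelCut_of_ge hθ (le_of_lt hy)
    rw [this.fderiv_eq]; simp

/-- The isoperimetric and Caccioppoli inequalities combined: the volume of the superlevel set and
the bulk energy in a half ball are controlled by the same quantities in a half annulus. -/
theorem exists_volume_rpow_add_lintegral_le (hm : 1 ≤ m) (hp : 1 < p) (hQ : 1 ≤ Q) (hC₀ : 1 ≤ C₀)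
    (hθ : θ ∈ Ioo (-1 : ℝ) 1) :
    ∃ C : ℝ, 0 < C ∧
      ∀ (L : ℝ≥0) (F G : ℝ → ℝ) (u : Space (m + 1) → ℝ), IsDoubleWell p C₀ F G →
        LipschitzWith L u → IsQMinimizer p Q F G u → ∀ (x₀ : Space (m + 1)) (r : ℝ),
          volume (halfBall x₀ r ∩ {x | θ < u x}) ^ ((m : ℝ) / (m + 1)) +
              ∫⁻ x in halfBall x₀ r, bulkDensity p F u x ≤
            ENNReal.ofReal C * ∫⁻ x in (Metric.ball x₀ (r + 5) \ Metric.ball x₀ r) ∩ halfSpace m,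
              totalDensity p θ F u x := by
  obtain ⟨A, hA1, hA⟩ := exists_doubleWell_bounds hp hC₀ hθ
  have hm0 : (0 : ℝ) < m := by exact_mod_cast hm
  have hA0 : 0 ≤ A := by linarith
  set κ := 2 / (1 + θ) with hκ_def
  have hκ : 0 < κ := div_pos (by norm_num) (by linarith [hθ.1])
  set M := Q * (1 + 2 * (C₀ * 2 ^ p)) with hM
  have hM0 : 0 < M := by positivity
  set B := A * (1 + κ) with hB
  have hB0 : 0 < B := by positivity
  refine ⟨B * (M * A + 1) + M * A, by positivity, ?_⟩
  intro L F G u hW hL hu x₀ r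
  have hum := hL.continuous.measurable
  have hbm : Measurable (bulkDensity p F u) := measurable_bulkDensity hW.measurable_F hum
  set J := ∫⁻ x in (Metric.ball x₀ (r + 5) \ Metric.ball x₀ r) ∩ halfSpace m,
    totalDensity p θ F u x with hJ
  have hbt : ∀ x, bulkDensity p F u x ≤ totalDensity p θ F u x := fun x => le_self_add
  have htot : ∀ x, θ < u x →
      totalDensity p θ F u x = ENNReal.ofReal (‖fderiv ℝ u x‖ ^ p + F (u x) + 1) := by
    intro x hx
    have h1 := (hW.nonneg _ (hu.mem_Icc x)).1
    have h2 := norm_nonneg (fderiv ℝ u x)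
    rw [totalDensity, bulkDensity, indicator_of_mem (show x ∈ {x | θ < u x} from hx), Pi.one_apply,
      ENNReal.ofReal_add (by positivity) zero_le_one, ENNReal.ofReal_one]
  have hpt1 : ∀ x, ENNReal.ofReal ((1 + u x + ‖fderiv ℝ u x‖) ^ p) ≤
      ENNReal.ofReal A * totalDensity p θ F u x := by
    intro x
    obtain ⟨h1, h2, -⟩ := hA F G hW (u x) (hu.mem_Icc x) _ (norm_nonneg (fderiv ℝ u x))
    by_cases hx : θ < u x
    · rw [htot x hx, ← ENNReal.ofReal_mul hA0]
      exact ENNReal.ofReal_le_ofReal h1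
    · refine le_trans ?_ (mul_le_mul_right (hbt x) _)
      rw [bulkDensity, ← ENNReal.ofReal_mul hA0]
      exact ENNReal.ofReal_le_ofReal (h2 (not_lt.1 hx))
  -- The Caccioppoli inequality at radius `r + 2` involves radii from `r + 1` to `r + 5`; this is
  -- the origin of the step `5`.
  have hcacc : ∀ s, r ≤ s → s ≤ r + 2 →
      ∫⁻ x in halfBall x₀ s, bulkDensity p F u x ≤ ENNReal.ofReal (M * A) * J := by
    intro s hs1 hs2
    have h0 : ∫⁻ x in halfBall x₀ s, bulkDensity p F u x ≤
        ∫⁻ x in halfBall x₀ (r + 2), bulkDensity p F u x :=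
      lintegral_mono_set (inter_subset_inter_left _ (Metric.ball_subset_ball hs2))
    refine h0.trans ((lintegral_bulkDensity_le_energy (G := G) x₀ (r + 2)).trans
      ((energy_ball_le_lintegral_annulus hp hQ hC₀ hW hL hu x₀ (r + 2)).trans ?_))
    rw [ENNReal.ofReal_mul hM0.le, mul_assoc]
    refine mul_le_mul_right ?_ _
    rw [hJ, ← lintegral_const_mul' _ _ ENNReal.ofReal_ne_top]
    refine (lintegral_mono hpt1).trans (lintegral_mono_set (inter_subset_inter_left _ ?_))
    refine sdiff_subset_sdiff (Metric.ball_subset_ball (by linarith))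
      (Metric.ball_subset_ball (by linarith))
  have hlev : LipschitzWith (Real.toNNReal κ * L) fun x => levelCut θ (u x) :=
    (lipschitzWith_levelCut hθ.1).comp hL
  set w : Space (m + 1) → ℝ := fun x => levelCut θ (u x) * cutoff x₀ r x with hw
  have hwL : LipschitzWith (Real.toNNReal κ * L * 1 + 1 * 1) w := by
    refine lipschitzWith_mul_of_bounded hlev (lipschitzWith_cutoff x₀ r) (fun x => ?_) fun x => ?_
    · rw [abs_of_nonneg (levelCut_nonneg _ _)]; exact levelCut_le_one _ _
    · rw [abs_of_nonneg (cutoff_nonneg _ _ _)]; exact cutoff_le_one _ _ _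
  have hsob := lintegral_halfSpace_rpow_le hm hwL (x₀ := x₀) (R := r + 1) fun x hx => by
    simp only [hw]
    rw [cutoff_eq_zero (not_lt.1 hx), mul_zero]
  have hpt2 : ∀ x, ENNReal.ofReal (levelCut θ (u x)) ≤ ENNReal.ofReal B * totalDensity p θ F u x := by
    intro x
    obtain ⟨-, -, h3⟩ := hA F G hW (u x) (hu.mem_Icc x) _ (norm_nonneg (fderiv ℝ u x))
    have hF := (hW.nonneg _ (hu.mem_Icc x)).1
    have hD := norm_nonneg (fderiv ℝ u x)
    have hAB : A ≤ B := by rw [hB]; nlinarith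
    by_cases hx : θ < u x
    · rw [htot x hx, ← ENNReal.ofReal_mul hB0.le]
      refine ENNReal.ofReal_le_ofReal ((levelCut_le_one _ _).trans ?_)
      have : 0 ≤ ‖fderiv ℝ u x‖ ^ p + F (u x) := by positivity
      nlinarith
    · by_cases hx' : (θ - 1) / 2 ≤ u x
      · refine le_trans ?_ (mul_le_mul_right (hbt x) _)
        rw [bulkDensity, ← ENNReal.ofReal_mul hB0.le]
        refine ENNReal.ofReal_le_ofReal ((levelCut_le_one _ _).trans
          ((h3 hx' (not_lt.1 hx)).2.trans ?_))
        gcongr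
      · rw [levelCut_of_le hθ.1 (not_le.1 hx').le]
        simp
  have hpt3 : ∀ x, DifferentiableAt ℝ u x →
      ENNReal.ofReal ‖fderiv ℝ (fun y => levelCut θ (u y)) x‖ ≤
        ENNReal.ofReal B * bulkDensity p F u x := by
    intro x hd
    obtain ⟨-, -, h3⟩ := hA F G hW (u x) (hu.mem_Icc x) _ (norm_nonneg (fderiv ℝ u x))
    by_cases hx : u x < (θ - 1) / 2 ∨ θ < u x
    · rw [fderiv_levelCut_comp_eq_zero hθ.1 hL.continuous hx]; simp
    · push Not at hx
      have h4 := (h3 hx.1 hx.2).1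
      have h5 := norm_fderiv_comp_le hd (lipschitzWith_levelCut hθ.1)
      rw [Real.coe_toNNReal _ hκ.le] at h5
      rw [bulkDensity, ← ENNReal.ofReal_mul hB0.le]
      refine ENNReal.ofReal_le_ofReal (h5.trans ?_)
      have hF := (hW.nonneg _ (hu.mem_Icc x)).1
      have h6 : 0 ≤ A * (‖fderiv ℝ u x‖ ^ p + F (u x)) := by positivity
      calc κ * ‖fderiv ℝ u x‖ ≤ κ * (A * (‖fderiv ℝ u x‖ ^ p + F (u x))) := by gcongr
        _ ≤ B * (‖fderiv ℝ u x‖ ^ p + F (u x)) := by rw [hB]; nlinarith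
  set S₁ := Metric.ball x₀ (r + 2) with hS₁
  set S₂ := Metric.ball x₀ (r + 2) \ Metric.ball x₀ r with hS₂
  have hS₁m : MeasurableSet S₁ := Metric.isOpen_ball.measurableSet
  have hS₂m : MeasurableSet S₂ := hS₁m.diff Metric.isOpen_ball.measurableSet
  -- The term with the gradient of the truncation costs bulk energy on `S₁`; the term with `∇ζ`
  -- lives in `S₂`, where the volume of `{θ < u}` is also paid for.
  have hgrad : ∀ᵐ x, ‖fderiv ℝ w x‖ₑ ≤ S₁.indicator (fun x => ENNReal.ofReal B * bulkDensity p F u x) x +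
      S₂.indicator (fun x => ENNReal.ofReal B * totalDensity p θ F u x) x := by
    filter_upwards [hL.ae_differentiableAt (μ := volume), hlev.ae_differentiableAt (μ := volume),
      (lipschitzWith_cutoff x₀ r).ae_differentiableAt (μ := volume)] with x hd hd1 hd2
    have hder := (hd1.hasFDerivAt.mul hd2.hasFDerivAt).fderiv
    have hle : ‖fderiv ℝ w x‖ ≤ levelCut θ (u x) * ‖fderiv ℝ (cutoff x₀ r) x‖ +
        cutoff x₀ r x * ‖fderiv ℝ (fun y => levelCut θ (u y)) x‖ := by
      rw [hw]
      change ‖fderiv ℝ ((fun y => levelCut θ (u y)) * cutoff x₀ r) x‖ ≤ _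
      rw [hder]
      refine (norm_add_le _ _).trans (le_of_eq ?_)
      rw [norm_smul, norm_smul, Real.norm_of_nonneg (levelCut_nonneg _ _),
        Real.norm_of_nonneg (cutoff_nonneg _ _ _)]
    have hz : ‖fderiv ℝ (cutoff x₀ r) x‖ ≤ 1 :=
      norm_fderiv_le_of_lipschitz ℝ (lipschitzWith_cutoff x₀ r)
    have hl0 := levelCut_nonneg θ (u x)
    have hc0 := cutoff_nonneg x₀ r x
    have hc1 := cutoff_le_one x₀ r x
    have hn0 := norm_nonneg (fderiv ℝ (fun y => levelCut θ (u y)) x)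
    rw [← ofReal_norm]
    by_cases hx1 : x ∈ S₁
    · rw [indicator_of_mem hx1]
      by_cases hx2 : x ∈ S₂
      · rw [indicator_of_mem hx2]
        refine le_trans ?_ ((add_le_add (hpt2 x) (hpt3 x hd)).trans_eq (add_comm _ _))
        rw [← ENNReal.ofReal_add hl0 hn0]
        refine ENNReal.ofReal_le_ofReal (hle.trans ?_)
        nlinarith
      · have hxr : dist x x₀ < r := by
          by_contra hxr
          exact hx2 ⟨hx1, hxr⟩
        rw [fderiv_cutoff_of_lt hxr] at hle
        refine le_trans ?_ ((hpt3 x hd).trans le_self_add)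
        refine ENNReal.ofReal_le_ofReal (hle.trans ?_)
        rw [norm_zero]
        nlinarith
    · have hxr : r + 2 ≤ dist x x₀ := not_lt.1 hx1
      rw [fderiv_cutoff_of_gt (by linarith), cutoff_eq_zero (by linarith), norm_zero] at hle
      simp only [mul_zero, zero_mul, add_zero] at hle
      rw [ENNReal.ofReal_of_nonpos hle]
      exact zero_le
  have hint : ∫⁻ x in halfSpace m, ‖fderiv ℝ w x‖ₑ ≤ ENNReal.ofReal (B * (M * A + 1)) * J := by
    refine (lintegral_mono_ae (ae_restrict_of_ae hgrad)).trans ?_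
    rw [lintegral_add_left ((hbm.const_mul _).indicator hS₁m), setLIntegral_indicator hS₁m,
      setLIntegral_indicator hS₂m, lintegral_const_mul' _ _ ENNReal.ofReal_ne_top,
      lintegral_const_mul' _ _ ENNReal.ofReal_ne_top, ← mul_add, ENNReal.ofReal_mul hB0.le, mul_assoc]
    refine mul_le_mul_right ?_ _
    rw [ENNReal.ofReal_add (by positivity) zero_le_one, ENNReal.ofReal_one, add_mul, one_mul]
    refine add_le_add (hcacc (r + 2) (by linarith) le_rfl) ?_
    refine lintegral_mono_set (inter_subset_inter_left _ ?_)
    exact sdiff_subset_sdiff_left (Metric.ball_subset_ball (by linarith))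
  have hvol : volume (halfBall x₀ r ∩ {x | θ < u x}) ^ ((m : ℝ) / (m + 1)) ≤
      ENNReal.ofReal (B * (M * A + 1)) * J := by
    refine le_trans ?_ hint
    have h1 : volume (halfBall x₀ r ∩ {x | θ < u x}) ≤
        (∫⁻ x in halfSpace m, ‖fderiv ℝ w x‖ₑ) ^ ((m + 1 : ℝ) / m) := by
      refine le_trans ?_ hsob
      rw [← setLIntegral_one]
      have hms : MeasurableSet (halfBall x₀ r ∩ {x | θ < u x}) :=
        (Metric.isOpen_ball.measurableSet.inter measurableSet_halfSpace).inter
          (measurableSet_lt measurable_const hum)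
      refine (setLIntegral_mono' hms (g := fun x => ‖w x‖ₑ ^ ((m + 1 : ℝ) / m)) ?_).trans
        (lintegral_mono_set fun x hx => hx.1.2)
      intro x hx
      have hx1 : dist x x₀ < r := hx.1.1
      have hx2 : θ < u x := hx.2
      simp only [hw]
      rw [levelCut_of_ge hθ.1 hx2.le, cutoff_eq_one hx1.le]
      simp
    calc _ ≤ ((∫⁻ x in halfSpace m, ‖fderiv ℝ w x‖ₑ) ^ ((m + 1 : ℝ) / m)) ^ ((m : ℝ) / (m + 1)) :=
          ENNReal.rpow_le_rpow h1 (by positivity)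
      _ = _ := by
          rw [← ENNReal.rpow_mul]
          have : (m + 1 : ℝ) / m * (m / (m + 1)) = 1 := by field_simp
          rw [this, ENNReal.rpow_one]
  calc _ ≤ ENNReal.ofReal (B * (M * A + 1)) * J + ENNReal.ofReal (M * A) * J :=
        add_le_add hvol (hcacc r le_rfl (by linarith))
    _ = _ := by rw [← add_mul, ← ENNReal.ofReal_add (by positivity) (by positivity)]

end Density

/-! ### Discrete growth lemma. -/

/-- A discrete differential inequality `a' ≥ c a^(m/(m+1))` forces growth of order `m + 1`. -/
theorem exists_pow_le_of_add_rpow_le (m : ℕ) {c μ : ℝ} (hc : 0 < c) (hμ : 0 < μ) :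
    ∃ b : ℝ, 0 < b ∧ ∀ a : ℕ → ℝ, μ ≤ a 0 →
      (∀ k, a k + c * a k ^ ((m : ℝ) / (m + 1)) ≤ a (k + 1)) →
        ∀ k : ℕ, (b * (k + 1)) ^ (m + 1) ≤ a k := by
  set d := c / ((m + 1) * 2 ^ m) with hd
  have hd0 : 0 < d := by positivity
  -- `b ≤ 1` and `b ≤ μ` start the induction; `b ≤ d` gives `(y + b)^(m+1) - y^(m+1) ≤ (m+1) b
  -- (2y)^m ≤ c y^m` for `y ≥ b`.
  set b := min 1 (min μ d) with hb
  have hb0 : 0 < b := by positivity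
  have hbd : (m + 1) * 2 ^ m * b ≤ c := by
    have : b ≤ d := (min_le_right _ _).trans (min_le_right _ _)
    rw [hd, le_div_iff₀ (by positivity)] at this
    linarith
  refine ⟨b, hb0, fun a ha0 ha k => ?_⟩
  induction k with
  | zero =>
    have h1 : b ^ (m + 1) ≤ b := pow_le_of_le_one hb0.le (min_le_left _ _) (by simp)
    have h2 : b ≤ μ := (min_le_right _ _).trans (min_le_left _ _)
    simpa using h1.trans (h2.trans ha0)
  | succ k ih =>
    set y := b * ((k : ℝ) + 1) with hy
    have hy0 : 0 ≤ y := by positivity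
    have hyb : b ≤ y := by rw [hy]; nlinarith [(Nat.cast_nonneg k : (0 : ℝ) ≤ k)]
    have h1 : y ^ m ≤ a k ^ ((m : ℝ) / (m + 1)) := by
      calc y ^ m = (y ^ (m + 1)) ^ ((m : ℝ) / (m + 1)) := by
            rw [← Real.rpow_natCast, ← Real.rpow_natCast, ← Real.rpow_mul hy0]
            congr 1
            push_cast
            field_simp
        _ ≤ _ := Real.rpow_le_rpow (by positivity) ih (by positivity)
    have h2 := pow_succ_sub_pow_succ_le hy0 (by linarith : y ≤ y + b) m
    have h3 : (y + b) ^ m ≤ (2 * y) ^ m := pow_le_pow_left₀ (by positivity) (by linarith) m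
    have h4 : (m + 1) * (y + b - y) * (y + b) ^ m ≤ c * y ^ m := by
      calc (m + 1) * (y + b - y) * (y + b) ^ m ≤ (m + 1) * b * (2 * y) ^ m := by
            rw [add_sub_cancel_left]; gcongr
        _ = ((m + 1) * 2 ^ m * b) * y ^ m := by rw [mul_pow]; ring
        _ ≤ _ := by gcongr
    have h5 : b * (((k + 1 : ℕ) : ℝ) + 1) = y + b := by rw [hy]; push_cast; ring
    rw [h5]
    have h6 : c * y ^ m ≤ c * a k ^ ((m : ℝ) / (m + 1)) := by gcongr
    linarith [ha k]

/-! ### The symmetry exchanging the two wells. -/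

section Reflection

variable {m : ℕ} {p Q C₀ : ℝ} {F G : ℝ → ℝ} {u : Space (m + 1) → ℝ}

theorem energy_neg (Ω : Set (Space (m + 1))) :
    energy p (fun τ => F (-τ)) (fun τ => G (-τ)) Ω (fun x => -u x) = energy p F G Ω u := by
  simp only [energy, neg_neg]
  congr 2
  funext x
  rw [fderiv_fun_neg, norm_neg]

theorem IsDoubleWell.comp_neg (hW : IsDoubleWell p C₀ F G) :
    IsDoubleWell p C₀ (fun τ => F (-τ)) (fun τ => G (-τ)) := by
  have h : ∀ τ ∈ Icc (-1 : ℝ) 1, -τ ∈ Icc (-1 : ℝ) 1 := fun τ hτ =>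
    ⟨by linarith [hτ.2], by linarith [hτ.1]⟩
  refine ⟨hW.measurable_F.comp measurable_neg, hW.measurable_G.comp measurable_neg,
    fun τ hτ => hW.nonneg _ (h τ hτ), fun τ hτ => ?_, fun τ hτ => ?_⟩
  · simpa using hW.upper _ (h τ hτ)
  · simpa using hW.lower _ (h τ hτ)

theorem IsQMinimizer.neg (hu : IsQMinimizer p Q F G u) :
    IsQMinimizer p Q (fun τ => F (-τ)) (fun τ => G (-τ)) (fun x => -u x) where
  mem_Icc x := ⟨by linarith [(hu.mem_Icc x).2], by linarith [(hu.mem_Icc x).1]⟩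
  energy_lt_top Ω hΩ hΩ' := by
    rw [energy_neg]
    exact hu.energy_lt_top Ω hΩ hΩ'
  energy_le Ω hΩ hΩ' φ hφ hs hφI := by
    obtain ⟨K, hK⟩ := hφ
    have h1 := hu.energy_le Ω hΩ hΩ' (fun x => -φ x) ⟨K, hK.neg⟩
      ((closure_mono fun x hx => by simpa using hx).trans hs)
      fun x => ⟨by linarith [(hφI x).2], by linarith [(hφI x).1]⟩
    rw [energy_neg]
    have h2 : (fun x => -u x + φ x) = fun x => -(u x + -φ x) := by funext x; ring
    rwa [h2, energy_neg]

end Reflection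

/-! ### Density estimates and conclusion. -/

/-- Density estimate for the superlevel sets. -/
theorem exists_le_volume_superlevel {m : ℕ} (hm : 1 ≤ m) {p Q C₀ θ μ₁ μ₂ : ℝ} (hp : 1 < p)
    (hQ : 1 ≤ Q) (hC₀ : 1 ≤ C₀) (L : ℝ≥0) (hθ : θ ∈ Ioo (-1 : ℝ) 1) (hμ₁ : 0 < μ₁)
    (hμ₂ : 0 < μ₂) :
    ∃ r₀ c : ℝ, 0 < r₀ ∧ 0 < c ∧
      ∀ (F G : ℝ → ℝ) (u : Space (m + 1) → ℝ), IsDoubleWell p C₀ F G →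
        LipschitzWith L u → IsQMinimizer p Q F G u → ∀ x₀ : Space (m + 1),
          ENNReal.ofReal μ₂ ≤ volume (halfBall x₀ μ₁ ∩ {x | θ < u x}) →
            ∀ r : ℝ, r₀ ≤ r →
              ENNReal.ofReal (c * r ^ (m + 1)) ≤ volume (halfBall x₀ r ∩ {x | θ < u x}) := by
  obtain ⟨C₁, hC₁, henergy⟩ := exists_energy_ball_le m hp hQ hC₀ L
  obtain ⟨C₂, hC₂, hgrowth⟩ := exists_volume_rpow_add_lintegral_le hm hp hQ hC₀ hθ
  set q : ℝ := (m : ℝ) / (m + 1) with hq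
  have hq0 : 0 ≤ q := by positivity
  have hq1 : q ≤ 1 := by rw [hq, div_le_one (by positivity)]; linarith
  -- In `(E + V)^q ≤ E^q + V^q ≤ E + 1 + V^q` the `1` is absorbed by `V^q / μ₂^q`, since `V ≥ μ₂`.
  set N : ℝ := 1 + 1 / μ₂ ^ q with hN
  have hμq : 0 < μ₂ ^ q := by positivity
  have hN1 : 1 ≤ N := by
    have : 0 ≤ 1 / μ₂ ^ q := by positivity
    linarith
  obtain ⟨b, hb, hseq⟩ := exists_pow_le_of_add_rpow_le m (c := 1 / (C₂ * N)) (by positivity) hμ₂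
  set d := (b / 10) ^ (m + 1) with hd
  have hd0 : 0 < d := by positivity
  -- `r ≥ 2 μ₁` leaves `r - μ₁ ≥ r / 2`, so steps of length `5` give `k + 1 ≥ r / 10`, whence the
  -- `10` in `d`. `r ≥ 2 C₁ / d` makes the energy `C₁ r^m` at most half of `d r^(m+1)`.
  refine ⟨max 1 (max (2 * μ₁) (2 * C₁ / d)), d / 2, by positivity, by positivity, ?_⟩
  intro F G u hW hL hu x₀ hx₀ r hr
  have hr1 : 1 ≤ r := (le_max_left _ _).trans hr
  have hr2 : 2 * μ₁ ≤ r := ((le_max_left _ _).trans (le_max_right _ _)).trans hr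
  have hr3 : 2 * C₁ / d ≤ r := ((le_max_right _ _).trans (le_max_right _ _)).trans hr
  have hum := hL.continuous.measurable
  have hlm : MeasurableSet {x | θ < u x} := measurableSet_lt measurable_const hum
  set V : ℝ → ℝ≥0∞ := fun s => volume (halfBall x₀ s ∩ {x | θ < u x}) with hV
  set E : ℝ → ℝ≥0∞ := fun s => ∫⁻ x in halfBall x₀ s, bulkDensity p F u x with hE
  set X : ℝ → ℝ≥0∞ := fun s => ∫⁻ x in halfBall x₀ s, totalDensity p θ F u x with hX
  have hsplit : ∀ s, X s = E s + V s := by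
    intro s
    simp only [hX, hE, hV, totalDensity]
    rw [lintegral_add_left (measurable_bulkDensity hW.measurable_F hum),
      setLIntegral_indicator hlm]
    simp [inter_comm]
  have hVfin : ∀ s, V s ≠ ∞ := fun s =>
    ((measure_mono fun x hx => hx.1.1).trans_lt (measure_ball_lt_top (x := x₀) (r := s))).ne
  have hEfin : ∀ s, E s ≠ ∞ := fun s =>
    ((lintegral_bulkDensity_le_energy (G := G) x₀ s).trans_lt
      (hu.energy_lt_top _ Metric.isOpen_ball Metric.isBounded_ball)).ne
  have hXfin : ∀ s, X s ≠ ∞ := fun s => by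
    rw [hsplit]; exact ENNReal.add_ne_top.2 ⟨hEfin s, hVfin s⟩
  have hVmono : ∀ s t, s ≤ t → V s ≤ V t := fun s t hst =>
    measure_mono (inter_subset_inter_left _ (inter_subset_inter_left _ (Metric.ball_subset_ball hst)))
  have hXmono : ∀ s t, s ≤ t → X s ≤ X t := fun s t hst =>
    lintegral_mono_set (inter_subset_inter_left _ (Metric.ball_subset_ball hst))
  have hstep : ∀ s, μ₁ ≤ s →
      (X s).toReal + 1 / (C₂ * N) * (X s).toReal ^ q ≤ (X (s + 5)).toReal := by
    intro s hs
    set J := ∫⁻ x in (Metric.ball x₀ (s + 5) \ Metric.ball x₀ s) ∩ halfSpace m,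
      totalDensity p θ F u x with hJ
    have hXJ : X s + J = X (s + 5) := by
      simp only [hX, hJ]
      rw [← lintegral_union ((Metric.isOpen_ball.measurableSet.diff
        Metric.isOpen_ball.measurableSet).inter measurableSet_halfSpace)]
      · congr 2
        rw [halfBall, halfBall, ← union_inter_distrib_right,
          union_sdiff_cancel (Metric.ball_subset_ball (by linarith))]
      · exact (disjoint_sdiff_self_right.mono inter_subset_left inter_subset_left)
    have hJfin : J ≠ ∞ := fun h => hXfin (s + 5) (by rw [← hXJ, h]; simp)
    have hg := hgrowth L F G u hW hL hu x₀ s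
    have hg' : (V s).toReal ^ q + (E s).toReal ≤ C₂ * J.toReal := by
      have h := ENNReal.toReal_mono (ENNReal.mul_ne_top ENNReal.ofReal_ne_top hJfin) hg
      rwa [ENNReal.toReal_add (ENNReal.rpow_ne_top_of_nonneg hq0 (hVfin s)) (hEfin s),
        ENNReal.toReal_mul, ENNReal.toReal_ofReal hC₂.le, ← ENNReal.toReal_rpow] at h
    have hVμ : μ₂ ≤ (V s).toReal :=
      (ENNReal.ofReal_le_iff_le_toReal (hVfin s)).1 (hx₀.trans (hVmono _ _ hs))
    have hv0 : 0 ≤ (V s).toReal := ENNReal.toReal_nonneg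
    have he0 : 0 ≤ (E s).toReal := ENNReal.toReal_nonneg
    have hVq : μ₂ ^ q ≤ (V s).toReal ^ q := Real.rpow_le_rpow hμ₂.le hVμ hq0
    have heq : (E s).toReal ^ q ≤ (E s).toReal + 1 := by
      rcases le_total (E s).toReal 1 with h | h
      · linarith [Real.rpow_le_one he0 h hq0]
      · have := Real.rpow_le_rpow_of_exponent_le h hq1
        rw [Real.rpow_one] at this
        linarith
    have hone : 1 ≤ 1 / μ₂ ^ q * (V s).toReal ^ q := by
      rw [one_div, ← div_eq_inv_mul, le_div_iff₀ hμq]; linarith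
    have hxq : (X s).toReal ^ q ≤ N * (C₂ * J.toReal) := by
      rw [hsplit, ENNReal.toReal_add (hEfin s) (hVfin s)]
      calc ((E s).toReal + (V s).toReal) ^ q ≤ (E s).toReal ^ q + (V s).toReal ^ q :=
            Real.rpow_add_le_add_rpow he0 hv0 hq0 hq1
        _ ≤ N * ((V s).toReal ^ q + (E s).toReal) := by
            have : 0 ≤ 1 / μ₂ ^ q * (E s).toReal := by positivity
            rw [hN]
            nlinarith
        _ ≤ _ := by gcongr
    rw [← hXJ, ENNReal.toReal_add (hXfin s) hJfin]
    gcongr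
    rw [one_div, inv_mul_le_iff₀ (by positivity)]
    linarith
  have hlow : ∀ k : ℕ, (b * (k + 1)) ^ (m + 1) ≤ (X (μ₁ + 5 * k)).toReal := by
    refine hseq (fun k : ℕ => (X (μ₁ + 5 * k)).toReal) ?_ fun k => ?_
    · have h1 : ENNReal.ofReal μ₂ ≤ X μ₁ := hx₀.trans (by rw [hsplit]; exact le_add_self)
      simpa using (ENNReal.ofReal_le_iff_le_toReal (hXfin μ₁)).1 h1
    · have h5 : (0 : ℝ) ≤ 5 * k := by positivity
      have := hstep (μ₁ + 5 * k) (by linarith)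
      convert this using 3
      push_cast
      ring
  set k := ⌊(r - μ₁) / 5⌋₊ with hk
  have hk1 : μ₁ + 5 * k ≤ r := by
    have := Nat.floor_le (show 0 ≤ (r - μ₁) / 5 from div_nonneg (by linarith) (by norm_num))
    rw [← hk] at this
    linarith
  have hk2 : r / 10 ≤ k + 1 := by
    have := Nat.lt_floor_add_one ((r - μ₁) / 5)
    rw [← hk] at this
    linarith
  have hXr : d * r ^ (m + 1) ≤ (X r).toReal := by
    calc d * r ^ (m + 1) = (b * (r / 10)) ^ (m + 1) := by rw [hd, ← mul_pow]; ring
      _ ≤ (b * (k + 1)) ^ (m + 1) := by gcongr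
      _ ≤ (X (μ₁ + 5 * k)).toReal := hlow k
      _ ≤ _ := ENNReal.toReal_mono (hXfin r) (hXmono _ _ hk1)
  have hEr : (E r).toReal ≤ C₁ * r ^ m :=
    ENNReal.toReal_le_of_le_ofReal (by positivity)
      ((lintegral_bulkDensity_le_energy (G := G) x₀ r).trans (henergy F G u hW hL hu x₀ r hr1))
  rw [hsplit, ENNReal.toReal_add (hEfin r) (hVfin r)] at hXr
  refine (ENNReal.ofReal_le_iff_le_toReal (hVfin r)).2 ?_
  have hfin : C₁ * r ^ m ≤ d / 2 * r ^ (m + 1) := by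
    rw [div_le_iff₀ hd0] at hr3
    have : 0 ≤ r ^ m := by positivity
    rw [pow_succ]
    nlinarith
  linarith

end TracePhase

open TracePhase in
/-- Energy bound and density estimates for Lipschitz `Q`-minimizers in dimension `n = m + 1 ≥ 2`;
`L` is a Lipschitz constant of `u`. -/
theorem theorem1 (m : ℕ) (hm : 1 ≤ m) (p Q C₀ : ℝ) (hp : 1 < p) (hQ : 1 ≤ Q) (hC₀ : 1 ≤ C₀)
    (L : ℝ≥0) :
    (∃ C : ℝ, 0 < C ∧
      ∀ (F G : ℝ → ℝ) (u : Space (m + 1) → ℝ), IsDoubleWell p C₀ F G →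
        LipschitzWith L u → IsQMinimizer p Q F G u →
        ∀ x₀ ∈ closure (halfSpace m), ∀ R : ℝ, 1 ≤ R →
          energy p F G (Metric.ball x₀ R) u ≤ ENNReal.ofReal (C * R ^ m)) ∧
    (∀ θ ∈ Ioo (-1 : ℝ) 1, ∀ μ₁ μ₂ : ℝ, 0 < μ₁ → 0 < μ₂ →
      ∃ r₀ c : ℝ, 0 < r₀ ∧ 0 < c ∧
        ∀ (F G : ℝ → ℝ) (u : Space (m + 1) → ℝ), IsDoubleWell p C₀ F G →
          LipschitzWith L u → IsQMinimizer p Q F G u →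
          ∀ x₀ ∈ closure (halfSpace m),
            (ENNReal.ofReal μ₂ ≤ volume (halfBall x₀ μ₁ ∩ {x | θ < u x}) →
              ∀ r : ℝ, r₀ ≤ r →
                ENNReal.ofReal (c * r ^ (m + 1)) ≤ volume (halfBall x₀ r ∩ {x | θ < u x})) ∧
            (ENNReal.ofReal μ₂ ≤ volume (halfBall x₀ μ₁ ∩ {x | u x < θ}) →
              ∀ r : ℝ, r₀ ≤ r →
                ENNReal.ofReal (c * r ^ (m + 1)) ≤ volume (halfBall x₀ r ∩ {x | u x < θ}))) := by
  refine ⟨?_, fun θ hθ μ₁ μ₂ hμ₁ hμ₂ => ?_⟩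
  · obtain ⟨C, hC, h⟩ := exists_energy_ball_le m hp hQ hC₀ L
    exact ⟨C, hC, fun F G u hW hL hu x₀ _ R hR => h F G u hW hL hu x₀ R hR⟩
  · obtain ⟨r₁, c₁, hr₁, hc₁, h₁⟩ := exists_le_volume_superlevel hm hp hQ hC₀ L hθ hμ₁ hμ₂
    -- The set `{u < θ}` is the superlevel set of `-u` at level `-θ`.
    obtain ⟨r₂, c₂, hr₂, hc₂, h₂⟩ := exists_le_volume_superlevel (θ := -θ) hm hp hQ hC₀ L
      ⟨by linarith [hθ.2], by linarith [hθ.1]⟩ hμ₁ hμ₂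
    refine ⟨max r₁ r₂, min c₁ c₂, lt_max_of_lt_left hr₁, lt_min hc₁ hc₂, ?_⟩
    intro F G u hW hL hu x₀ _
    refine ⟨fun hvol r hr => ?_, fun hvol r hr => ?_⟩
    · have hr' : r₁ ≤ r := (le_max_left _ _).trans hr
      refine (ENNReal.ofReal_le_ofReal ?_).trans (h₁ F G u hW hL hu x₀ hvol r hr')
      exact mul_le_mul_of_nonneg_right (min_le_left _ _) (pow_nonneg (hr₁.le.trans hr') _)
    · have hr' : r₂ ≤ r := (le_max_right _ _).trans hr
      have h := h₂ _ _ _ hW.comp_neg hL.neg hu.neg x₀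
      simp only [Pi.neg_apply, neg_lt_neg_iff] at h
      refine (ENNReal.ofReal_le_ofReal ?_).trans (h hvol r hr')
      exact mul_le_mul_of_nonneg_right (min_le_right _ _) (pow_nonneg (hr₂.le.trans hr') _)
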